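/- Let $x^\mu$ ($\mu=0,\dots,n$) be coordinates on spacetime, $\varphi^a$ ($a=1,\dots,N$) coordinates on the target space, let $J$ be an open set of first-order jets $(x,\varphi,\partial\varphi)$, and let $\mathcal L=\mathcal L(x,\varphi,\partial\varphi)$ be a smooth Lagrangean density on $J$. By a field we mean a smooth map $\varphi$ on an open set $O$ of spacetime whose first-order jets lie in $J$. Put $$W^{\mu\nu}_{ab}=\frac{\partial^2\mathcal L}{\partial(\partial_\mu\varphi^a)\,\partial(\partial_\nu\varphi^b)},\qquad L_a=-\partial_\mu\frac{\partial\mathcal L}{\partial(\partial_\mu\varphi^a)}+\frac{\partial\mathcal L}{\partial\varphi^a}=-W^{\mu\nu}_{ab}\,\partial_\mu\partial_\nu\varphi^b+V_a ,$$ where $V_a$ is a function on $J$. Let the descriptors $A^{\alpha\mu},B^{\alpha a},C^{\alpha a\mu}$ ($\alpha=1,\dots,r$) be smooth functions of $(x,\varphi,\partial\varphi)\in J$, and for functions $\epsilon_\alpha(x)$ put $$\delta_\epsilon x^\mu=\epsilon_\alpha A^{\alpha\mu},\qquad \delta_\epsilon\varphi^a=\epsilon_\alpha B^{\alpha a}+\partial_\mu\epsilon_\alpha\,C^{\alpha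 a\mu},\qquad \bar\delta_\epsilon\varphi^a=\delta_\epsilon\varphi^a-\partial_\mu\varphi^a\,\delta_\epsilon x^\mu .$$ Assume that the action is invariant under these local transformations: for every field $\varphi$ on $O$ and every smooth $\epsilon$ with compact support in $O$ there is a smooth one-parameter family of transformations $x\mapsto x'=x'_s(x)$ (injective on $O$), $\varphi\mapsto\varphi'_s$, equal to the identity at $s=0$, with $\frac{d}{ds}x'_s(x)|_{s=0}=\delta_\epsilon x$ and $\frac{d}{ds}\varphi'_s(x'_s(x))|_{s=0}=\delta_\epsilon\varphi$, such that for every compact $K\subset O$ containing the support of $\epsilon$ and all sufficiently small $s$ $$\int_{x'_s(K)}\mathcal L(x',\varphi'_s,\partial'\varphi'_s)\,dx'=\int_K\mathcal L(x,\varphi,\partial\varphi)\,dx .$$ Then the following hold, without use of the equations of motion. 1. (Generalized Bianchi identities.) There are $\lambda^\mu=\epsilon_\alpha\lambda_0^{\alpha\mu}+\partial_\nu\epsilon_\alpha\lambda_1^{\alpha\mu\nu}$, with $\lambda_0$ a smooth function of $(x,\varphi,\partial\varphi,\partial\partial\varphi)$ and $\lambda_1$ a smooth function of $(x,\varphi,\partial\varphi)$,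 such that for all fields $\varphi$ and all smooth $\epsilon$ (not necessarily of compact support) $\delta\mathcal L+\mathcal L\,\partial_\mu\delta x^\mu=\partial_\mu\lambda^\mu$ and $$\partial_\mu\Big(\mathcal L\,\delta x^\mu+\frac{\partial\mathcal L}{\partial(\partial_\mu\varphi^a)}\bar\delta\varphi^a-\lambda^\mu\Big)+L_a\,\bar\delta\varphi^a=0 ;$$ moreover, for given $\varphi$ and $\epsilon$, the last identity holds for every smooth $\lambda^\mu$ with $\delta\mathcal L+\mathcal L\,\partial_\mu\delta x^\mu=\partial_\mu\lambda^\mu$. Here $\delta\mathcal L=\frac{\partial\mathcal L}{\partial\varphi^a}\delta\varphi^a+\frac{\partial\mathcal L}{\partial(\partial_\nu\varphi^a)}\big(\partial_\nu\delta\varphi^a-\partial_\mu\varphi^a\,\partial_\nu\delta x^\mu\big)+\frac{\partial\mathcal L}{\partial x^\mu}\delta x^\mu$, with $\partial\mathcal L/\partial x^\mu$ taken at fixed $\varphi,\partial\varphi$. 2. For every field and every $\alpha$, $L_a\big(B^{\alpha a}-\partial_\mu\varphi^aA^{\alpha\mu}\big)-\partial_\mu\big(L_aC^{\alpha a\mu}\big)=0$;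 equivalently, inserting $L_a=-W^{\rho\sigma}_{ab}\partial_\rho\partial_\sigma\varphi^b+V_a$, $$0=L_a\big(B^{\alpha a}-\partial_\mu\varphi^aA^{\alpha\mu}-\partial_\mu C^{\alpha a\mu}\big)-C^{\alpha a\mu}\partial_\mu V_a+C^{\alpha a\mu}\big(\partial_\mu W^{\rho\sigma}_{ab}\,\partial_\rho\partial_\sigma\varphi^b+W^{\rho\sigma}_{ab}\,\partial_\mu\partial_\rho\partial_\sigma\varphi^b\big).$$ 3. $C^{\alpha a(\mu}W^{\rho\sigma)}_{ab}=0$ on $J$, where the brackets denote symmetrization in $\mu,\rho,\sigma$. In particular $C^{\alpha a0}W^{00}_{ab}=0$, so that wherever $(C^{\alpha a0})_a\neq0$ it is a null vector of the Hessian $W^{00}$ and $\det W^{00}=0$. 4. If, for some $\alpha$, $C^{\alpha a\mu}\equiv0$ for all $a,\mu$, then $(B^{\alpha a}-\partial_\rho\varphi^aA^{\alpha\rho})L_a=0$ for every field and $(B^{\alpha a}-\partial_\rho\varphi^aA^{\alpha\rho})W^{(\mu\nu)}_{ab}=0$ on $J$; in particular $(B^{\alpha a}-\partial_\rho\varphi^aA^{\alpha\rho})_a$,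 wherever nonzero, is a null vector of $W^{00}$ and $\det W^{00}=0$. 5. (Gauge theories are necessarily singular.) $\det W^{00}=0$ at every jet in $J$ at which the functions $C^{\alpha a\mu}$ and $B^{\alpha a}-\partial_\mu\varphi^aA^{\alpha\mu}$ do not all vanish. Hence, if these functions do not all vanish identically on $J$, the system is not regular (that is, $W^{00}$ is not invertible everywhere on $J$), and if in addition $W^{00}$ has constant rank on $J$, then $\det W^{00}=0$ on all of $J$. -/

import Mathlib

open scoped ContDiff

noncomputable section

namespace GaugeBianchi

open MeasureTheory Set Filter Topology

/-- Spacetime coordinates `x^μ`, `μ = 0, …, n`; the evolution parameter is `x^0`. -/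
abbrev Spacetime (n : ℕ) := Fin (n + 1) → ℝ

/-- Coordinates `φ^a`, `a = 1, …, N`, of the target space. -/
abbrev Target (N : ℕ) := Fin N → ℝ

/-- First-order jets `(x, φ, ∂φ)`, with `j.2.2 a μ` standing for `∂_μ φ^a`. -/
abbrev Jet (n N : ℕ) := Spacetime n × Target N × (Fin N → Fin (n + 1) → ℝ)

/-- Second-order jets `((x, φ, ∂φ), ∂∂φ)`, with `k.2 a μ ν` standing for `∂_μ ∂_ν φ^a`. -/
abbrev Jet2 (n N : ℕ) := Jet n N × (Fin N → Fin (n + 1) → Fin (n + 1) → ℝ)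

variable {n N r : ℕ}

/-- The partial derivative `∂_μ f` of a function on spacetime. -/
def pd (μ : Fin (n + 1)) (f : Spacetime n → ℝ) (x : Spacetime n) : ℝ :=
  fderiv ℝ f x (Pi.single μ 1)

/-- The first-order jet `(x, φ(x), ∂φ(x))` of a field. -/
def jet (φ : Spacetime n → Target N) (x : Spacetime n) : Jet n N :=
  (x, φ x, fun a μ => pd μ (fun y => φ y a) x)

/-- The second-order jet of a field. -/
def jet2 (φ : Spacetime n → Target N) (x : Spacetime n) : Jet2 n N :=
  (jet φ x, fun a μ ν => pd μ (pd ν (fun y => φ y a)) x)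

/-- `∂F/∂x^μ` at fixed `φ`, `∂φ` (derivative with respect to the explicit `x`-dependence). -/
def dX (F : Jet n N → ℝ) (μ : Fin (n + 1)) (j : Jet n N) : ℝ :=
  fderiv ℝ F j (Pi.single μ 1, 0, 0)

/-- `∂F/∂φ^a`. -/
def dField (F : Jet n N → ℝ) (a : Fin N) (j : Jet n N) : ℝ :=
  fderiv ℝ F j (0, Pi.single a 1, 0)

/-- `∂F/∂(∂_μ φ^a)`. -/
def dVel (F : Jet n N → ℝ) (a : Fin N) (μ : Fin (n + 1)) (j : Jet n N) : ℝ :=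
  fderiv ℝ F j (0, 0, Pi.single a (Pi.single μ 1))

/-- `W^{μν}_{ab} = ∂²𝓛 / ∂(∂_μ φ^a) ∂(∂_ν φ^b)`. -/
def W (ℒ : Jet n N → ℝ) (μ ν : Fin (n + 1)) (a b : Fin N) (j : Jet n N) : ℝ :=
  dVel (dVel ℒ a μ) b ν j

/-- The Hessian `W^{00}` as an `N × N` matrix. -/
def hessian (ℒ : Jet n N → ℝ) (j : Jet n N) : Matrix (Fin N) (Fin N) ℝ :=
  Matrix.of fun a b => W ℒ 0 0 a b j

/-- The part `V_a(x, φ, ∂φ)` of the Euler derivative without second derivatives of the field. -/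
def V (ℒ : Jet n N → ℝ) (a : Fin N) (j : Jet n N) : ℝ :=
  dField ℒ a j - ∑ μ, ∑ b, dField (dVel ℒ a μ) b j * j.2.2 b μ - ∑ μ, dX (dVel ℒ a μ) μ j

/-- The Euler derivative `L_a = -∂_μ (∂𝓛/∂(∂_μ φ^a)) + ∂𝓛/∂φ^a` along the field `φ`. -/
def euler (ℒ : Jet n N → ℝ) (φ : Spacetime n → Target N) (a : Fin N) (x : Spacetime n) : ℝ :=
  -(∑ μ, pd μ (fun y => dVel ℒ a μ (jet φ y)) x) + dField ℒ a (jet φ x)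

/-- The action over a spacetime region `K`. -/
def action (ℒ : Jet n N → ℝ) (K : Set (Spacetime n)) (φ : Spacetime n → Target N) : ℝ :=
  ∫ x in K, ℒ (jet φ x)

/-- The coefficients `A^{αμ}`, `B^{αa}`, `C^{αaμ}` of an infinitesimal local transformation
`δx^μ = ε_α A^{αμ}`, `δφ^a = ε_α B^{αa} + ∂_μ ε_α C^{αaμ}`, `α = 1, …, r`. They are functions of
spacetime, the field and its first derivatives. -/
structure Descriptors (n N r : ℕ) where
  A : Fin r → Fin (n + 1) → Jet n N → ℝ
  B : Fin r → Fin N → Jet n N → ℝ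
  C : Fin r → Fin N → Fin (n + 1) → Jet n N → ℝ

namespace Descriptors

/-- All descriptors are smooth on the set `J` of jets. -/
def SmoothOn (D : Descriptors n N r) (J : Set (Jet n N)) : Prop :=
  (∀ α μ, ContDiffOn ℝ ∞ (D.A α μ) J) ∧ (∀ α a, ContDiffOn ℝ ∞ (D.B α a) J) ∧
    ∀ α a μ, ContDiffOn ℝ ∞ (D.C α a μ) J

/-- `δ_ε x^μ = ε_α A^{αμ}`. -/
def deltaX (D : Descriptors n N r) (ε : Spacetime n → Fin r → ℝ) (φ : Spacetime n → Target N)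
    (x : Spacetime n) : Spacetime n :=
  fun μ => ∑ α, ε x α * D.A α μ (jet φ x)

/-- `δ_ε φ^a = ε_α B^{αa} + ∂_μ ε_α C^{αaμ}`. -/
def deltaField (D : Descriptors n N r) (ε : Spacetime n → Fin r → ℝ)
    (φ : Spacetime n → Target N) (x : Spacetime n) : Target N :=
  fun a => ∑ α, ε x α * D.B α a (jet φ x)
    + ∑ α, ∑ μ, pd μ (fun y => ε y α) x * D.C α a μ (jet φ x)

/-- The variation at a fixed point, `δ̄φ^a = δφ^a - ∂_μ φ^a δx^μ`. -/
def deltaBar (D : Descriptors n N r) (ε : Spacetime n → Fin r → ℝ)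
    (φ : Spacetime n → Target N) (x : Spacetime n) : Target N :=
  fun a => D.deltaField ε φ x a - ∑ μ, pd μ (fun y => φ y a) x * D.deltaX ε φ x μ

/-- The combination `B^{αa} - ∂_μ φ^a A^{αμ}`. -/
def BA (D : Descriptors n N r) (α : Fin r) (a : Fin N) (j : Jet n N) : ℝ :=
  D.B α a j - ∑ μ, j.2.2 a μ * D.A α μ j

/-- The total variation
`δ𝓛 = (∂𝓛/∂φ^a) δφ^a + (∂𝓛/∂(∂_ν φ^a)) δ(∂_ν φ^a) + (∂𝓛/∂x^μ) δx^μ`, where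
`δ(∂_ν φ^a) = ∂_ν δφ^a - ∂_μ φ^a ∂_ν δx^μ`. -/
def deltaLagrangian (D : Descriptors n N r) (ℒ : Jet n N → ℝ) (ε : Spacetime n → Fin r → ℝ)
    (φ : Spacetime n → Target N) (x : Spacetime n) : ℝ :=
  ∑ a, dField ℒ a (jet φ x) * D.deltaField ε φ x a
    + ∑ a, ∑ ν, dVel ℒ a ν (jet φ x) *
        (pd ν (fun y => D.deltaField ε φ y a) x
          - ∑ μ, pd μ (fun y => φ y a) x * pd ν (fun y => D.deltaX ε φ y μ) x)
    + ∑ μ, dX ℒ μ (jet φ x) * D.deltaX ε φ x μ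

/-- At the jet `j` not all of the functions `C^{αaμ}`, `B^{αa} - ∂_μ φ^a A^{αμ}` vanish, so that
the local transformations really act on the fields there. -/
def ActsAt (D : Descriptors n N r) (j : Jet n N) : Prop :=
  ∃ α a, D.BA α a j ≠ 0 ∨ ∃ μ, D.C α a μ j ≠ 0

end Descriptors

/-- `φ` is a smooth field on the open region `O` whose first-order jets lie in `J`, the set on
which the Lagrangean density is defined. -/
def IsLocalField (J : Set (Jet n N)) (O : Set (Spacetime n)) (φ : Spacetime n → Target N) : Prop :=
  IsOpen O ∧ ContDiffOn ℝ ∞ φ O ∧ ∀ x ∈ O, jet φ x ∈ J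

/-- `(X_s, χ_s)`, `|s| < t`, is a smooth one-parameter family of finite transformations
`x ↦ x' = X_s(x)`, `φ ↦ φ' = χ_s` of the field `φ` on `O`, starting at the identity, with
`x' = x + s δx + o(s)` and `φ'(x') = φ(x) + s δφ(x) + o(s)`. -/
structure IsTransformation (O : Set (Spacetime n)) (φ : Spacetime n → Target N)
    (δx : Spacetime n → Spacetime n) (δφ : Spacetime n → Target N) (t : ℝ)
    (X : ℝ → Spacetime n → Spacetime n) (χ : ℝ → Spacetime n → Target N) : Prop where
  pos : 0 < t
  smooth_X : ContDiffOn ℝ ∞ (fun p : ℝ × Spacetime n => X p.1 p.2) (Ioo (-t) t ×ˢ O)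
  smooth_χ : ContDiffOn ℝ ∞ (fun p : ℝ × Spacetime n => χ p.1 p.2) (Ioo (-t) t ×ˢ O)
  injOn : ∀ s ∈ Ioo (-t) t, InjOn (X s) O
  X_zero : ∀ x ∈ O, X 0 x = x
  χ_zero : ∀ x ∈ O, χ 0 x = φ x
  deriv_X : ∀ x ∈ O, HasDerivAt (fun s => X s x) (δx x) 0
  deriv_χ : ∀ x ∈ O, HasDerivAt (fun s => χ s (X s x)) (δφ x) 0

/-- Invariance of the action under the local transformations with descriptors `D`: for every field
and every smooth parameter function `ε` with compact support in the region where the field is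
defined, there are finite transformations generated by `δ_ε x`, `δ_ε φ` with
`∫_{x'(K)} 𝓛(φ', ∂'φ', x') dx' = ∫_K 𝓛(φ, ∂φ, x) dx` for every compact region `K` containing
the support of `ε`. -/
def ActionInvariant (J : Set (Jet n N)) (ℒ : Jet n N → ℝ) (D : Descriptors n N r) : Prop :=
  ∀ (O : Set (Spacetime n)) (φ : Spacetime n → Target N), IsLocalField J O φ →
  ∀ ε : Spacetime n → Fin r → ℝ, ContDiff ℝ ∞ ε → HasCompactSupport ε → tsupport ε ⊆ O →
    ∃ t X χ, IsTransformation O φ (D.deltaX ε φ) (D.deltaField ε φ) t X χ ∧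
      ∀ K, IsCompact K → tsupport ε ⊆ K → K ⊆ O →
        ∀ᶠ s in 𝓝 (0 : ℝ), action ℒ (X s '' K) (χ s) = action ℒ K φ

/-- The system is regular if the Hessian `W^{00}` is invertible at all jets in `J`. -/
def IsRegularSystem (J : Set (Jet n N)) (ℒ : Jet n N → ℝ) : Prop :=
  ∀ j ∈ J, IsUnit (hessian ℒ j)

/-- The symmetric part `T^{(μρσ)}`. -/
def sym3 (T : Fin (n + 1) → Fin (n + 1) → Fin (n + 1) → ℝ) (μ ρ σ : Fin (n + 1)) : ℝ :=
  (T μ ρ σ + T μ σ ρ + T ρ μ σ + T ρ σ μ + T σ μ ρ + T σ ρ μ) / 6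

/-- The symmetric part `T^{(μν)}`. -/
def sym2 (T : Fin (n + 1) → Fin (n + 1) → ℝ) (μ ν : Fin (n + 1)) : ℝ :=
  (T μ ν + T ν μ) / 2

/-- `λ^μ = ε_α λ₀^{αμ} + ∂_ν ε_α λ₁^{αμν}`, where `λ₀` is a function of the second-order jet and
`λ₁` of the first-order jet of the field. -/
def localCurrent (l₀ : Fin r → Fin (n + 1) → Jet2 n N → ℝ)
    (l₁ : Fin r → Fin (n + 1) → Fin (n + 1) → Jet n N → ℝ)
    (ε : Spacetime n → Fin r → ℝ) (φ : Spacetime n → Target N) (μ : Fin (n + 1))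
    (x : Spacetime n) : ℝ :=
  ∑ α, ε x α * l₀ α μ (jet2 φ x)
    + ∑ α, ∑ ν, pd ν (fun y => ε y α) x * l₁ α μ ν (jet φ x)

/-- `δ𝓛 + 𝓛 ∂_μ δx^μ = ∂_μ λ^μ` at `x`. -/
def VariationIsDivergence (ℒ : Jet n N → ℝ) (D : Descriptors n N r)
    (ε : Spacetime n → Fin r → ℝ) (φ : Spacetime n → Target N)
    (lam : Fin (n + 1) → Spacetime n → ℝ) (x : Spacetime n) : Prop :=
  D.deltaLagrangian ℒ ε φ x + ℒ (jet φ x) * ∑ μ, pd μ (fun y => D.deltaX ε φ y μ) x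
    = ∑ μ, pd μ (lam μ) x

/-- The generalized Bianchi identity
`∂_μ (𝓛 δx^μ + ∂𝓛/∂(∂_μ φ^a) δ̄φ^a - λ^μ) + L_a δ̄φ^a = 0` at `x`. -/
def BianchiIdentity (ℒ : Jet n N → ℝ) (D : Descriptors n N r)
    (ε : Spacetime n → Fin r → ℝ) (φ : Spacetime n → Target N)
    (lam : Fin (n + 1) → Spacetime n → ℝ) (x : Spacetime n) : Prop :=
  ∑ μ, pd μ (fun y => ℒ (jet φ y) * D.deltaX ε φ y μ
      + ∑ a, dVel ℒ a μ (jet φ y) * D.deltaBar ε φ y a - lam μ y) x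
    + ∑ a, euler ℒ φ a x * D.deltaBar ε φ x a = 0

end GaugeBianchi

end

open GaugeBianchi

namespace GaugeBianchi

open MeasureTheory Set Filter Topology

variable {n N r : ℕ} {J : Set (Jet n N)} {O : Set (Spacetime n)} {φ : Spacetime n → Target N}
  {x : Spacetime n}

section PartialDerivatives

variable {f g : Spacetime n → ℝ}

/-! ### Partial derivatives -/

/-! The core is Noether's second theorem. For any variation, invariance or not, the product rule
gives pointwise δ𝓛 + 𝓛 ∂_μ δx^μ = ∂_μ j^μ + L_a δ̄φ^a with j^μ = 𝓛 δx^μ + (∂𝓛/∂(∂_μ φ^a)) δ̄φ^a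
(`variation_eq_divergence`). Pulling the transformed action back to K and differentiating at s = 0
shows that the left side integrates to zero over K (`setIntegral_variation_eq_zero`).

Moving the derivative off ε, L_a δ̄φ^a = ∂_μ(ε_α L_a C^{αaμ}) + ε_α E^α, where E^α is
`eulerIdentity`. For ε supported in K both divergences integrate to zero, so E^α is orthogonal to
every test function and vanishes (`eulerIdentity_eq_zero`). As E^α = 0 holds pointwise, λ^μ = j^μ +
ε_α L_a C^{αaμ} is a local current for arbitrary ε, and the Bianchi identities follow by
rearrangement.

The algebraic conditions come from comparing jets. E^α is affine in the third derivatives of the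
field, with coefficients C W. Two fields with the same second-order jet at a point that differ by a
cubic monomial isolate the symmetrized product (`sym3_C_mul_W`). When C vanishes identically,
quadratic monomials do the same for the contraction with B - ∂φ A (`sum_BA_mul_sym2_W`).

Singularity is local. If det W^{00} ≠ 0 at a jet, restrict everything to the open set where this
holds. There C^{αa0} is a null vector of an invertible matrix, hence zero; then so is each C^{αaμ},
and after that B - ∂φ A (`det_hessian_eq_zero_of_actsAt`). -/

lemma ContDiffOn.differentiableAt_of_isOpen {E F : Type*} [NormedAddCommGroup E]
    [NormedSpace ℝ E] [NormedAddCommGroup F] [NormedSpace ℝ F] {f : E → F} {s : Set E} {x : E}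
    (hf : ContDiffOn ℝ ∞ f s) (hs : IsOpen s) (hx : x ∈ s) : DifferentiableAt ℝ f x :=
  (hf.contDiffAt (hs.mem_nhds hx)).differentiableAt (by simp)

lemma contDiffOn_fderiv_const {E F : Type*} [NormedAddCommGroup E]
    [NormedSpace ℝ E] [NormedAddCommGroup F] [NormedSpace ℝ F] {f : E → F} {s : Set E}
    (hf : ContDiffOn ℝ ∞ f s) (hs : IsOpen s) (v : E) :
    ContDiffOn ℝ ∞ (fun x => fderiv ℝ f x v) s :=
  (hf.fderiv_of_isOpen hs (by simp)).clm_apply contDiffOn_const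

lemma contDiffOn_pd (hO : IsOpen O) (hf : ContDiffOn ℝ ∞ f O) (μ : Fin (n + 1)) :
    ContDiffOn ℝ ∞ (pd μ f) O :=
  contDiffOn_fderiv_const hf hO _

lemma pd_congr (h : f =ᶠ[𝓝 x] g) (μ : Fin (n + 1)) : pd μ f x = pd μ g x := by
  rw [pd, pd, h.fderiv_eq]

lemma pd_add (hf : DifferentiableAt ℝ f x) (hg : DifferentiableAt ℝ g x) (μ : Fin (n + 1)) :
    pd μ (fun y => f y + g y) x = pd μ f x + pd μ g x := by
  simp [pd, fderiv_fun_add hf hg]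

lemma pd_sub (hf : DifferentiableAt ℝ f x) (hg : DifferentiableAt ℝ g x) (μ : Fin (n + 1)) :
    pd μ (fun y => f y - g y) x = pd μ f x - pd μ g x := by
  simp [pd, fderiv_fun_sub hf hg]

lemma pd_neg (μ : Fin (n + 1)) : pd μ (fun y => -f y) x = -pd μ f x := by
  simp [pd, fderiv_fun_neg]

lemma pd_mul (hf : DifferentiableAt ℝ f x) (hg : DifferentiableAt ℝ g x) (μ : Fin (n + 1)) :
    pd μ (fun y => f y * g y) x = pd μ f x * g x + f x * pd μ g x := by
  simp [pd, fderiv_fun_mul hf hg]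
  ring

lemma pd_const (c : ℝ) (μ : Fin (n + 1)) : pd μ (fun _ => c) x = 0 := by
  simp [pd]

lemma pd_sum {ι : Type*} {s : Finset ι} {F : ι → Spacetime n → ℝ}
    (hF : ∀ i ∈ s, DifferentiableAt ℝ (F i) x) (μ : Fin (n + 1)) :
    pd μ (fun y => ∑ i ∈ s, F i y) x = ∑ i ∈ s, pd μ (F i) x := by
  simp [pd, fderiv_fun_sum hF]

lemma pd_comm (hO : IsOpen O) (hf : ContDiffOn ℝ ∞ f O) (hx : x ∈ O) (μ ν : Fin (n + 1)) :
    pd μ (pd ν f) x = pd ν (pd μ f) x := by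
  have hd : DifferentiableAt ℝ (fderiv ℝ f) x :=
    ContDiffOn.differentiableAt_of_isOpen (hf.fderiv_of_isOpen hO (by simp)) hO hx
  have key : ∀ u v : Spacetime n,
      fderiv ℝ (fun y => fderiv ℝ f y u) x v = fderiv ℝ (fderiv ℝ f) x v u := by
    intro u v
    rw [fderiv_clm_apply hd (differentiableAt_const u)]
    simp
  -- Over ℝ the smoothness required for a symmetric second derivative is 2, so the side goal is 2 ≤
  -- ∞.
  have hs := (hf.contDiffAt (hO.mem_nhds hx)).isSymmSndFDerivAt (by
    simpa using WithTop.coe_le_coe.2 (le_top (a := (2 : ℕ∞))))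
  change fderiv ℝ (fun y => fderiv ℝ f y _) x _ = fderiv ℝ (fun y => fderiv ℝ f y _) x _
  rw [key, key]
  exact hs.eq _ _

lemma pd_eq_of_comp (hf : DifferentiableAt ℝ φ x) (a : Fin N) (μ : Fin (n + 1)) :
    pd μ (fun y => φ y a) x = fderiv ℝ φ x (Pi.single μ 1) a := by
  rw [pd, fderiv_apply hf]
  rfl

lemma fderiv_apply_eq_sum_pd (f : Spacetime n → ℝ) (x v : Spacetime n) :
    fderiv ℝ f x v = ∑ μ, v μ * pd μ f x := by
  conv_lhs => rw [pi_eq_sum_univ' v]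
  simp [pd, map_sum]

end PartialDerivatives

/-! ### Jets of fields -/

lemma fderiv_jet_apply (F : Jet n N → ℝ) (j : Jet n N) (v : Jet n N) :
    fderiv ℝ F j v = ∑ μ, v.1 μ * dX F μ j + ∑ a, v.2.1 a * dField F a j
      + ∑ a, ∑ μ, v.2.2 a μ * dVel F a μ j := by
  have hv : v = ∑ μ, v.1 μ • ((Pi.single μ 1, 0, 0) : Jet n N)
      + ∑ a, v.2.1 a • ((0, Pi.single a 1, 0) : Jet n N)
      + ∑ a, ∑ μ, v.2.2 a μ • ((0, 0, Pi.single a (Pi.single μ 1)) : Jet n N) := by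
    refine Prod.ext ?_ (Prod.ext ?_ ?_)
    · ext ν
      simp [Prod.fst_sum, Finset.sum_apply, Pi.single_apply]
    · ext ν
      simp [Prod.fst_sum, Prod.snd_sum, Finset.sum_apply, Pi.single_apply]
    · ext b ν
      simp only [Prod.snd_add, Prod.snd_sum, Prod.smul_snd, smul_zero, Finset.sum_const_zero,
        zero_add, Finset.sum_apply, Pi.smul_apply, Pi.single_apply, smul_eq_mul]
      rw [Finset.sum_eq_single b (fun a _ h => by simp [h.symm]) (by simp)]
      simp [Pi.single_apply]
  conv_lhs => rw [hv]
  simp only [map_add, map_sum, map_smul, smul_eq_mul, dX, dField, dVel]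

lemma contDiffOn_dX {F : Jet n N → ℝ} (hJ : IsOpen J) (hF : ContDiffOn ℝ ∞ F J)
    (μ : Fin (n + 1)) : ContDiffOn ℝ ∞ (dX F μ) J :=
  contDiffOn_fderiv_const hF hJ _

lemma contDiffOn_dField {F : Jet n N → ℝ} (hJ : IsOpen J) (hF : ContDiffOn ℝ ∞ F J)
    (a : Fin N) : ContDiffOn ℝ ∞ (dField F a) J :=
  contDiffOn_fderiv_const hF hJ _

lemma contDiffOn_dVel {F : Jet n N → ℝ} (hJ : IsOpen J) (hF : ContDiffOn ℝ ∞ F J)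
    (a : Fin N) (μ : Fin (n + 1)) : ContDiffOn ℝ ∞ (dVel F a μ) J :=
  contDiffOn_fderiv_const hF hJ _

lemma contDiffOn_W {ℒ : Jet n N → ℝ} (hJ : IsOpen J) (hℒ : ContDiffOn ℝ ∞ ℒ J)
    (μ ν : Fin (n + 1)) (a b : Fin N) : ContDiffOn ℝ ∞ (W ℒ μ ν a b) J :=
  contDiffOn_dVel hJ (contDiffOn_dVel hJ hℒ a μ) b ν

lemma contDiff_jet_velocity (a : Fin N) (μ : Fin (n + 1)) :
    ContDiff ℝ ∞ (fun j : Jet n N => j.2.2 a μ) := by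
  have h : ContDiff ℝ ∞ (fun j : Jet n N => j.2.2) := contDiff_snd.snd
  exact contDiff_pi.1 (contDiff_pi.1 h a) μ

lemma contDiffOn_V {ℒ : Jet n N → ℝ} (hJ : IsOpen J) (hℒ : ContDiffOn ℝ ∞ ℒ J) (a : Fin N) :
    ContDiffOn ℝ ∞ (V ℒ a) J := by
  refine ((contDiffOn_dField hJ hℒ a).sub ?_).sub ?_
  · exact ContDiffOn.sum fun μ _ => ContDiffOn.sum fun b _ =>
      (contDiffOn_dField hJ (contDiffOn_dVel hJ hℒ a μ) b).mul
        (contDiff_jet_velocity b μ).contDiffOn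
  · exact ContDiffOn.sum fun μ _ => contDiffOn_dX hJ (contDiffOn_dVel hJ hℒ a μ) μ

lemma IsLocalField.contDiffOn_comp (h : IsLocalField J O φ) (a : Fin N) :
    ContDiffOn ℝ ∞ (fun y => φ y a) O :=
  contDiffOn_pi.1 h.2.1 a

lemma IsLocalField.contDiffOn_pd (h : IsLocalField J O φ) (a : Fin N) (μ : Fin (n + 1)) :
    ContDiffOn ℝ ∞ (pd μ (fun y => φ y a)) O :=
  GaugeBianchi.contDiffOn_pd h.1 (h.contDiffOn_comp a) μ

lemma contDiffOn_jet (hO : IsOpen O) (h : ContDiffOn ℝ ∞ φ O) : ContDiffOn ℝ ∞ (jet φ) O :=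
  contDiffOn_id.prodMk (h.prodMk (contDiffOn_pi.2 fun a => contDiffOn_pi.2 fun μ =>
    contDiffOn_pd hO (contDiffOn_pi.1 h a) μ))

lemma IsLocalField.contDiffOn_along (h : IsLocalField J O φ) {F : Jet n N → ℝ}
    (hF : ContDiffOn ℝ ∞ F J) : ContDiffOn ℝ ∞ (fun y => F (jet φ y)) O :=
  hF.comp (contDiffOn_jet h.1 h.2.1) h.2.2

/-- Chain rule for a function of the first-order jet. -/
lemma pd_along_jet (hJ : IsOpen J) (h : IsLocalField J O φ) {F : Jet n N → ℝ}
    (hF : ContDiffOn ℝ ∞ F J) (hx : x ∈ O) (μ : Fin (n + 1)) :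
    pd μ (fun y => F (jet φ y)) x = dX F μ (jet φ x)
      + ∑ b, pd μ (fun y => φ y b) x * dField F b (jet φ x)
      + ∑ b, ∑ ν, pd μ (pd ν (fun y => φ y b)) x * dVel F b ν (jet φ x) := by
  have hFd := ContDiffOn.differentiableAt_of_isOpen hF hJ (h.2.2 x hx)
  have hjd := ContDiffOn.differentiableAt_of_isOpen (contDiffOn_jet h.1 h.2.1) h.1 hx
  have hφd := ContDiffOn.differentiableAt_of_isOpen h.2.1 h.1 hx
  have hpd := fun a μ => ContDiffOn.differentiableAt_of_isOpen (h.contDiffOn_pd a μ) h.1 hx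
  have hv : HasFDerivAt (jet φ) ((ContinuousLinearMap.id ℝ _).prod ((fderiv ℝ φ x).prod
      (ContinuousLinearMap.pi fun a => ContinuousLinearMap.pi fun ν =>
        fderiv ℝ (pd ν (fun y => φ y a)) x))) x :=
    (hasFDerivAt_id x).prodMk (hφd.hasFDerivAt.prodMk (hasFDerivAt_pi.2 fun a =>
      hasFDerivAt_pi.2 fun ν => (hpd a ν).hasFDerivAt))
  have := (hFd.hasFDerivAt.comp x hv).fderiv
  change fderiv ℝ (F ∘ jet φ) x _ = _
  rw [this, ContinuousLinearMap.comp_apply, fderiv_jet_apply]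
  congr 1
  congr 1
  · simp [Pi.single_apply]
  · refine Finset.sum_congr rfl fun b _ => ?_
    rw [pd_eq_of_comp hφd]
    rfl

/-! ### The Euler derivative -/

/-- The chain rule applied to the momenta ∂𝓛/∂(∂_μ φ^a): second derivatives of the field enter only
through their velocity dependence, which is W. -/
lemma euler_eq (hJ : IsOpen J) {ℒ : Jet n N → ℝ} (hℒ : ContDiffOn ℝ ∞ ℒ J)
    (h : IsLocalField J O φ) (hx : x ∈ O) (a : Fin N) :
    euler ℒ φ a x = -(∑ μ, ∑ ν, ∑ b, W ℒ μ ν a b (jet φ x) * pd μ (pd ν (fun y => φ y b)) x)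
      + V ℒ a (jet φ x) := by
  have hμ : ∀ μ, pd μ (fun y => dVel ℒ a μ (jet φ y)) x = dX (dVel ℒ a μ) μ (jet φ x)
      + ∑ b, dField (dVel ℒ a μ) b (jet φ x) * (jet φ x).2.2 b μ
      + ∑ ν, ∑ b, W ℒ μ ν a b (jet φ x) * pd μ (pd ν (fun y => φ y b)) x := by
    intro μ
    rw [pd_along_jet hJ h (contDiffOn_dVel hJ hℒ a μ) hx, Finset.sum_comm (s := Finset.univ)]
    simp only [W, jet, mul_comm]
  rw [euler, V, Finset.sum_congr rfl fun μ _ => hμ μ]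
  simp only [Finset.sum_add_distrib]
  ring

lemma IsLocalField.contDiffOn_euler (h : IsLocalField J O φ) (hJ : IsOpen J) {ℒ : Jet n N → ℝ}
    (hℒ : ContDiffOn ℝ ∞ ℒ J) (a : Fin N) : ContDiffOn ℝ ∞ (euler ℒ φ a) O := by
  refine (ContDiffOn.neg (ContDiffOn.sum fun μ _ => ?_)).add
    (h.contDiffOn_along (contDiffOn_dField hJ hℒ a))
  exact GaugeBianchi.contDiffOn_pd h.1 (h.contDiffOn_along (contDiffOn_dVel hJ hℒ a μ)) μ

lemma pd_euler (hJ : IsOpen J) {ℒ : Jet n N → ℝ} (hℒ : ContDiffOn ℝ ∞ ℒ J)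
    (h : IsLocalField J O φ) (hx : x ∈ O) (a : Fin N) (μ : Fin (n + 1)) :
    pd μ (euler ℒ φ a) x = -(∑ ρ, ∑ σ, ∑ b,
      (pd μ (fun y => W ℒ ρ σ a b (jet φ y)) x * pd ρ (pd σ (fun y => φ y b)) x
        + W ℒ ρ σ a b (jet φ x) * pd μ (pd ρ (pd σ (fun y => φ y b))) x))
      + pd μ (fun y => V ℒ a (jet φ y)) x := by
  have hW : ∀ ρ σ b, DifferentiableAt ℝ (fun y => W ℒ ρ σ a b (jet φ y)) x := fun ρ σ b =>
    ContDiffOn.differentiableAt_of_isOpen (h.contDiffOn_along (contDiffOn_W hJ hℒ ρ σ a b)) h.1 hx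
  have hp : ∀ ρ σ b, DifferentiableAt ℝ (pd ρ (pd σ (fun y => φ y b))) x := fun ρ σ b =>
    ContDiffOn.differentiableAt_of_isOpen
      (GaugeBianchi.contDiffOn_pd h.1 (h.contDiffOn_pd b σ) ρ) h.1 hx
  have hV : DifferentiableAt ℝ (fun y => V ℒ a (jet φ y)) x :=
    ContDiffOn.differentiableAt_of_isOpen (h.contDiffOn_along (contDiffOn_V hJ hℒ a)) h.1 hx
  have he : euler ℒ φ a =ᶠ[𝓝 x] fun y =>
      -(∑ μ, ∑ ν, ∑ b, W ℒ μ ν a b (jet φ y) * pd μ (pd ν (fun y => φ y b)) y)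
      + V ℒ a (jet φ y) :=
    (h.1.eventually_mem hx).mono fun y hy => euler_eq hJ hℒ h hy a
  have h3 : ∀ ρ σ b, DifferentiableAt ℝ
      (fun y => W ℒ ρ σ a b (jet φ y) * pd ρ (pd σ (fun y => φ y b)) y) x :=
    fun ρ σ b => (hW ρ σ b).mul (hp ρ σ b)
  have h2 : ∀ ρ σ, DifferentiableAt ℝ
      (fun y => ∑ b, W ℒ ρ σ a b (jet φ y) * pd ρ (pd σ (fun y => φ y b)) y) x :=
    fun ρ σ => DifferentiableAt.fun_sum fun b _ => h3 ρ σ b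
  have h1 : ∀ ρ, DifferentiableAt ℝ
      (fun y => ∑ σ, ∑ b, W ℒ ρ σ a b (jet φ y) * pd ρ (pd σ (fun y => φ y b)) y) x :=
    fun ρ => DifferentiableAt.fun_sum fun σ _ => h2 ρ σ
  rw [pd_congr he, pd_add (DifferentiableAt.fun_sum fun ρ _ => h1 ρ).fun_neg hV, pd_neg,
    pd_sum fun ρ _ => h1 ρ]
  congr 2
  refine Finset.sum_congr rfl fun ρ _ => ?_
  rw [pd_sum fun σ _ => h2 ρ σ]
  refine Finset.sum_congr rfl fun σ _ => ?_
  rw [pd_sum fun b _ => h3 ρ σ b]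
  exact Finset.sum_congr rfl fun b _ => pd_mul (hW ρ σ b) (hp ρ σ b) μ

/-! ### The variation of the Lagrangean density as a divergence plus Euler terms -/

/-- Only the product and chain rules are at work. The second derivatives of φ produced by ∂_ν ζ
cancel those produced by differentiating 𝓛 along the jet, and the derivatives of the momenta cancel
against the Euler derivative. No invariance enters. -/
lemma variation_eq_divergence (hJ : IsOpen J) {ℒ : Jet n N → ℝ} (hℒ : ContDiffOn ℝ ∞ ℒ J)
    (h : IsLocalField J O φ) {ξ : Spacetime n → Spacetime n} {η ζ : Spacetime n → Target N}
    (hξ : ContDiffOn ℝ ∞ ξ O) (hη : ContDiffOn ℝ ∞ η O)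
    (hζ : ∀ y a, ζ y a = η y a - ∑ μ, pd μ (fun y => φ y a) y * ξ y μ) (hx : x ∈ O) :
    ∑ a, dField ℒ a (jet φ x) * η x a
      + ∑ a, ∑ ν, dVel ℒ a ν (jet φ x) * (pd ν (fun y => η y a) x
          - ∑ μ, pd μ (fun y => φ y a) x * pd ν (fun y => ξ y μ) x)
      + ∑ μ, dX ℒ μ (jet φ x) * ξ x μ
      + ℒ (jet φ x) * ∑ μ, pd μ (fun y => ξ y μ) x
    = ∑ μ, pd μ (fun y => ℒ (jet φ y) * ξ y μ + ∑ a, dVel ℒ a μ (jet φ y) * ζ y a) x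
      + ∑ a, euler ℒ φ a x * ζ x a := by
  have dξ : ∀ μ, DifferentiableAt ℝ (fun y => ξ y μ) x := fun μ =>
    ContDiffOn.differentiableAt_of_isOpen (contDiffOn_pi.1 hξ μ) h.1 hx
  have dη : ∀ a, DifferentiableAt ℝ (fun y => η y a) x := fun a =>
    ContDiffOn.differentiableAt_of_isOpen (contDiffOn_pi.1 hη a) h.1 hx
  have dφ : ∀ a μ, DifferentiableAt ℝ (pd μ (fun y => φ y a)) x := fun a μ =>
    ContDiffOn.differentiableAt_of_isOpen (h.contDiffOn_pd a μ) h.1 hx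
  have dL : DifferentiableAt ℝ (fun y => ℒ (jet φ y)) x :=
    ContDiffOn.differentiableAt_of_isOpen (h.contDiffOn_along hℒ) h.1 hx
  have dP : ∀ a μ, DifferentiableAt ℝ (fun y => dVel ℒ a μ (jet φ y)) x := fun a μ =>
    ContDiffOn.differentiableAt_of_isOpen (h.contDiffOn_along (contDiffOn_dVel hJ hℒ a μ)) h.1 hx
  have hζ' : ∀ a, (fun y => ζ y a) = fun y => η y a - ∑ μ, pd μ (fun y => φ y a) y * ξ y μ :=
    fun a => funext fun y => hζ y a
  have dS : ∀ a μ, DifferentiableAt ℝ (fun y => pd μ (fun y => φ y a) y * ξ y μ) x :=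
    fun a μ => (dφ a μ).mul (dξ μ)
  have dζ : ∀ a, DifferentiableAt ℝ (fun y => ζ y a) x := fun a => by
    rw [hζ']
    exact (dη a).sub (DifferentiableAt.fun_sum fun μ _ => dS a μ)
  have pdζ : ∀ a ν, pd ν (fun y => ζ y a) x = pd ν (fun y => η y a) x
      - ∑ μ, (pd ν (pd μ (fun y => φ y a)) x * ξ x μ
        + pd μ (fun y => φ y a) x * pd ν (fun y => ξ y μ) x) := fun a ν => by
    rw [hζ', pd_sub (dη a) (DifferentiableAt.fun_sum fun μ _ => dS a μ), pd_sum fun μ _ => dS a μ]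
    simp only [pd_mul (dφ a _) (dξ _)]
  have hdiv : ∀ μ, pd μ (fun y => ℒ (jet φ y) * ξ y μ + ∑ a, dVel ℒ a μ (jet φ y) * ζ y a) x
      = pd μ (fun y => ℒ (jet φ y)) x * ξ x μ + ℒ (jet φ x) * pd μ (fun y => ξ y μ) x
        + ∑ a, (pd μ (fun y => dVel ℒ a μ (jet φ y)) x * ζ x a
          + dVel ℒ a μ (jet φ x) * pd μ (fun y => ζ y a) x) := fun μ => by
    rw [pd_add (dL.fun_mul (dξ μ)) (DifferentiableAt.fun_sum fun a _ => (dP a μ).fun_mul (dζ a)),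
      pd_mul dL (dξ μ), pd_sum fun a _ => (dP a μ).fun_mul (dζ a)]
    simp only [pd_mul (dP _ μ) (dζ _)]
  simp only [hdiv, pdζ, pd_along_jet hJ h hℒ hx, euler]
  have e1 : ∑ μ, (∑ b, pd μ (fun y => φ y b) x * dField ℒ b (jet φ x)) * ξ x μ
      = ∑ a, dField ℒ a (jet φ x) * (η x a - ζ x a) := by
    simp only [hζ, sub_sub_cancel, Finset.sum_mul, Finset.mul_sum]
    rw [Finset.sum_comm]
    exact Finset.sum_congr rfl fun a _ => Finset.sum_congr rfl fun μ _ => by ring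
  -- This cancellation is the one that needs the second partial derivatives to commute.
  have e2 : ∑ μ, (∑ b, ∑ ν, pd μ (pd ν (fun y => φ y b)) x * dVel ℒ b ν (jet φ x)) * ξ x μ
      = ∑ a, ∑ ν, dVel ℒ a ν (jet φ x) * ∑ μ, pd ν (pd μ (fun y => φ y a)) x * ξ x μ := by
    simp only [Finset.sum_mul, Finset.mul_sum]
    rw [Finset.sum_comm]
    refine Finset.sum_congr rfl fun a _ => ?_
    rw [Finset.sum_comm]
    refine Finset.sum_congr rfl fun ν _ => Finset.sum_congr rfl fun μ _ => ?_
    rw [pd_comm h.1 (h.contDiffOn_comp a) hx μ ν]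
    ring
  have e3 : ∑ μ, ∑ a, pd μ (fun y => dVel ℒ a μ (jet φ y)) x * ζ x a
      = ∑ a, (∑ μ, pd μ (fun y => dVel ℒ a μ (jet φ y)) x) * ζ x a := by
    rw [Finset.sum_comm]
    simp only [Finset.sum_mul]
  have e4 : ∀ T : Fin N → Fin (n + 1) → ℝ, ∑ μ, ∑ a, dVel ℒ a μ (jet φ x) * T a μ
      = ∑ a, ∑ μ, dVel ℒ a μ (jet φ x) * T a μ := fun T => Finset.sum_comm
  simp only [add_mul, Finset.sum_add_distrib, neg_mul, Finset.sum_neg_distrib] at *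
  rw [e1, e2, e3, e4 fun a μ => pd μ (fun y => η y a) x - (∑ ν, pd μ (pd ν (fun y => φ y a)) x
    * ξ x ν + ∑ ν, pd ν (fun y => φ y a) x * pd μ (fun y => ξ y ν) x)]
  simp only [mul_sub, mul_add, Finset.sum_sub_distrib, Finset.sum_add_distrib, Finset.mul_sum]
  ring

/-! ### The derivative of the determinant at the identity -/

lemma contDiff_det (m : ℕ) :
    ContDiff ℝ ∞ (fun M : Fin m → Fin m → ℝ => (Matrix.of M).det) := by
  simp only [Matrix.det_apply', Matrix.of_apply]
  exact ContDiff.sum fun σ _ => contDiff_const.mul (contDiff_prod fun i _ =>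
    contDiff_pi.1 (contDiff_pi.1 contDiff_id (σ i)) i)

lemma hasDerivAt_det_of_eq_one {m : ℕ} {A : ℝ → Fin m → Fin m → ℝ} {M : Fin m → Fin m → ℝ}
    (h0 : Matrix.of (A 0) = 1) (hA : HasDerivAt A M 0) :
    HasDerivAt (fun s => (Matrix.of (A s)).det) (∑ i, M i i) 0 := by
  have hd := ((contDiff_det m).differentiable (by simp) (A 0)).hasFDerivAt
  have hl : HasDerivAt (fun s : ℝ => A 0 + s • M) M 0 := by
    simpa using ((hasDerivAt_id (0 : ℝ)).smul_const M).const_add (A 0)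
  have h1 := HasFDerivAt.comp_hasDerivAt_of_eq (0 : ℝ) hd hl (by simp)
  obtain ⟨p, hp⟩ : ∃ p : Polynomial ℝ, ∀ s : ℝ,
      ((1 : Matrix (Fin m) (Fin m) ℝ) + s • Matrix.of M).det
        = 1 + (Matrix.of M).trace * s + p.eval s * s ^ 2 :=
    ⟨_, fun s => Matrix.det_one_add_smul s (Matrix.of M)⟩
  have h2 : HasDerivAt (fun s : ℝ => 1 + (Matrix.of M).trace * s + p.eval s * s ^ 2)
      (Matrix.of M).trace 0 := by
    have := (((hasDerivAt_id (0 : ℝ)).const_mul (Matrix.of M).trace).const_add 1).fun_add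
      ((p.hasDerivAt 0).fun_mul (hasDerivAt_pow 2 (0 : ℝ)))
    simpa using this
  have h3 := h1.unique (h2.congr_of_eventuallyEq (Eventually.of_forall fun s => by
    refine Eq.trans ?_ (hp s)
    rw [← h0]
    rfl))
  have h4 := hd.comp_hasDerivAt (0 : ℝ) hA
  rw [h3] at h4
  exact h4

/-! ### Differentiation of integrals over a compact set -/

/-- The tube lemma. It is needed because the domain on which the pulled-back integrand is smooth is
open in (s, x) but not a product. -/
lemma eventually_forall_mem_of_isCompact {Ω : Set (ℝ × Spacetime n)} {K : Set (Spacetime n)}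
    (hΩ : IsOpen Ω) (hK : IsCompact K) (hKΩ : ∀ x ∈ K, ((0 : ℝ), x) ∈ Ω) :
    ∀ᶠ s in 𝓝 (0 : ℝ), ∀ x ∈ K, (s, x) ∈ Ω := by
  obtain ⟨u, v, hu, -, h0u, hKv, huv⟩ := generalized_tube_lemma (isCompact_singleton (x := (0 : ℝ)))
    hK hΩ (by rintro ⟨s, x⟩ ⟨rfl, hx⟩; exact hKΩ x hx)
  exact (hu.eventually_mem (h0u rfl)).mono fun s hs x hx => huv ⟨hs, hKv hx⟩

/-- Dominated convergence: the parameter derivative is continuous, hence bounded on a compact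
parameter interval times K, and constants are integrable on K. -/
lemma hasDerivAt_setIntegral_of_contDiffOn {G : ℝ × Spacetime n → ℝ} {Ω : Set (ℝ × Spacetime n)}
    {K : Set (Spacetime n)} (hΩ : IsOpen Ω) (hG : ContDiffOn ℝ ∞ G Ω) (hK : IsCompact K)
    (hKΩ : ∀ x ∈ K, ((0 : ℝ), x) ∈ Ω) :
    HasDerivAt (fun s => ∫ x in K, G (s, x)) (∫ x in K, fderiv ℝ G (0, x) (1, 0)) 0 := by
  obtain ⟨δ, hδ, hball⟩ := Metric.eventually_nhds_iff_ball.1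
    (eventually_forall_mem_of_isCompact hΩ hK hKΩ)
  -- Halving the radius makes room for a closed, hence compact, ball.
  have hsub : ∀ s ∈ Metric.closedBall (0 : ℝ) (δ / 2), ∀ x ∈ K, (s, x) ∈ Ω := fun s hs =>
    hball s (Metric.closedBall_subset_ball (by linarith) hs)
  have hG' : ContinuousOn (fun p => fderiv ℝ G p (1, 0)) Ω :=
    (contDiffOn_fderiv_const hG hΩ _).continuousOn
  have hslice : ∀ (H : ℝ × Spacetime n → ℝ), ContinuousOn H Ω →
      ∀ s ∈ Metric.closedBall (0 : ℝ) (δ / 2), ContinuousOn (fun x => H (s, x)) K :=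
    fun H hH s hs => hH.comp (by fun_prop) fun x hx => hsub s hs x hx
  have hcomp : IsCompact (Metric.closedBall (0 : ℝ) (δ / 2) ×ˢ K) :=
    (isCompact_closedBall _ _).prod hK
  obtain ⟨M, hM⟩ := hcomp.exists_bound_of_continuousOn
    (hG'.mono fun p hp => hsub p.1 hp.1 p.2 hp.2)
  have h0 : (0 : ℝ) ∈ Metric.closedBall (0 : ℝ) (δ / 2) := by simp; positivity
  have hnhds : Metric.closedBall (0 : ℝ) (δ / 2) ∈ 𝓝 (0 : ℝ) :=
    Metric.closedBall_mem_nhds _ (by positivity)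
  have hKm := hK.measurableSet
  refine (hasDerivAt_integral_of_dominated_loc_of_deriv_le (μ := volume.restrict K)
    (F := fun s x => G (s, x)) (F' := fun s x => fderiv ℝ G (s, x) (1, 0)) (bound := fun _ => M)
    hnhds ?_ ?_ ?_ ?_ ?_ ?_).2
  · exact Filter.mem_of_superset hnhds fun s hs =>
      (hslice G hG.continuousOn s hs).aestronglyMeasurable hKm
  · exact (hslice G hG.continuousOn 0 h0).integrableOn_compact hK
  · exact (hslice _ hG' 0 h0).aestronglyMeasurable hKm
  · exact (ae_restrict_mem hKm).mono fun x hx s hs => hM (s, x) ⟨hs, hx⟩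
  · have : IsFiniteMeasure (volume.restrict K) := ⟨by simpa using hK.measure_lt_top⟩
    exact integrable_const M
  · refine (ae_restrict_mem hKm).mono fun x hx s hs => ?_
    have hd := (ContDiffOn.differentiableAt_of_isOpen hG hΩ (hsub s hs x hx)).hasFDerivAt
    exact hd.comp_hasDerivAt s ((hasDerivAt_id s).prodMk (hasDerivAt_const s x))

/-- Exchange of the parameter derivative with a spatial derivative. -/
lemma fderiv_param_fderiv_space {F : Type*} [NormedAddCommGroup F] [NormedSpace ℝ F]
    {Φ : ℝ × Spacetime n → F} {U : Set (ℝ × Spacetime n)} (hU : IsOpen U)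
    (hΦ : ContDiffOn ℝ ∞ Φ U) (hx : ((0 : ℝ), x) ∈ U) (v : Spacetime n) :
    fderiv ℝ (fun p => fderiv ℝ Φ p (0, v)) (0, x) (1, 0)
      = fderiv ℝ (fun y => fderiv ℝ Φ (0, y) (1, 0)) x v := by
  have hd : DifferentiableAt ℝ (fderiv ℝ Φ) (0, x) :=
    ContDiffOn.differentiableAt_of_isOpen (hΦ.fderiv_of_isOpen hU (by simp)) hU hx
  have hs := (hΦ.contDiffAt (hU.mem_nhds hx)).isSymmSndFDerivAt (by
    simpa using WithTop.coe_le_coe.2 (le_top (a := (2 : ℕ∞))))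
  have h1 : HasFDerivAt (fun y : Spacetime n => fderiv ℝ Φ ((0 : ℝ), y) (1, 0))
      ((((fderiv ℝ (fderiv ℝ Φ) (0, x)).flip (1, 0))).comp
        (ContinuousLinearMap.inr ℝ ℝ (Spacetime n))) x := by
    have h2 : HasFDerivAt (fun p => fderiv ℝ Φ p (1, 0))
        ((fderiv ℝ (fderiv ℝ Φ) (0, x)).flip (1, 0)) (0, x) := by
      have := hd.hasFDerivAt.clm_apply (hasFDerivAt_const ((1 : ℝ), (0 : Spacetime n)) (0, x))
      simpa using this
    exact h2.comp x (hasFDerivAt_prodMk_right (0 : ℝ) x)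
  rw [h1.fderiv, fderiv_clm_apply hd (differentiableAt_const _)]
  simpa using hs.eq (1, 0) (0, v)

lemma fderiv_slice {F : Type*} [NormedAddCommGroup F] [NormedSpace ℝ F]
    {Φ : ℝ → Spacetime n → F} {s : ℝ}
    (h : DifferentiableAt ℝ (fun p : ℝ × Spacetime n => Φ p.1 p.2) (s, x)) (v : Spacetime n) :
    fderiv ℝ (Φ s) x v = fderiv ℝ (fun p : ℝ × Spacetime n => Φ p.1 p.2) (s, x) (0, v) := by
  have := (h.hasFDerivAt.comp x (hasFDerivAt_prodMk_right s x)).fderiv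
  change fderiv ℝ (Φ s) x = _ at this
  rw [this]
  rfl

/-! ### The first variation of the action -/

namespace IsTransformation

variable {ξ : Spacetime n → Spacetime n} {η : Spacetime n → Target N} {t : ℝ}
  {X : ℝ → Spacetime n → Spacetime n} {χ : ℝ → Spacetime n → Target N}

lemma zero_mem (hT : IsTransformation O φ ξ η t X χ) (hx : x ∈ O) :
    ((0 : ℝ), x) ∈ Ioo (-t) t ×ˢ O :=
  ⟨⟨by linarith [hT.pos], hT.pos⟩, hx⟩

lemma differentiableAt_X (hT : IsTransformation O φ ξ η t X χ) (hO : IsOpen O)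
    {p : ℝ × Spacetime n} (hp : p ∈ Ioo (-t) t ×ˢ O) :
    DifferentiableAt ℝ (fun p : ℝ × Spacetime n => X p.1 p.2) p :=
  ContDiffOn.differentiableAt_of_isOpen hT.smooth_X (isOpen_Ioo.prod hO) hp

lemma differentiableAt_χ (hT : IsTransformation O φ ξ η t X χ) (hO : IsOpen O)
    {p : ℝ × Spacetime n} (hp : p ∈ Ioo (-t) t ×ˢ O) :
    DifferentiableAt ℝ (fun p : ℝ × Spacetime n => χ p.1 p.2) p :=
  ContDiffOn.differentiableAt_of_isOpen hT.smooth_χ (isOpen_Ioo.prod hO) hp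

lemma fderiv_X_zero (hT : IsTransformation O φ ξ η t X χ) (hO : IsOpen O) (hx : x ∈ O)
    (v : Spacetime n) :
    fderiv ℝ (fun p : ℝ × Spacetime n => X p.1 p.2) (0, x) (0, v) = v := by
  have he : X 0 =ᶠ[𝓝 x] id := (hO.eventually_mem hx).mono hT.X_zero
  rw [← fderiv_slice (hT.differentiableAt_X hO (hT.zero_mem hx)), he.fderiv_eq]
  simp

lemma fderiv_χ_zero (hT : IsTransformation O φ ξ η t X χ) (hO : IsOpen O) (hx : x ∈ O)
    (v : Spacetime n) :
    fderiv ℝ (fun p : ℝ × Spacetime n => χ p.1 p.2) (0, x) (0, v) = fderiv ℝ φ x v := by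
  have he : χ 0 =ᶠ[𝓝 x] φ := (hO.eventually_mem hx).mono hT.χ_zero
  rw [← fderiv_slice (hT.differentiableAt_χ hO (hT.zero_mem hx)), he.fderiv_eq]

lemma fderiv_X_param (hT : IsTransformation O φ ξ η t X χ) (hO : IsOpen O) (hx : x ∈ O) :
    fderiv ℝ (fun p : ℝ × Spacetime n => X p.1 p.2) (0, x) (1, 0) = ξ x := by
  have h1 := (hT.differentiableAt_X hO (hT.zero_mem hx)).hasFDerivAt.comp_hasDerivAt (0 : ℝ)
    ((hasDerivAt_id (0 : ℝ)).prodMk (hasDerivAt_const (0 : ℝ) x))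
  exact h1.unique (hT.deriv_X x hx)

lemma hasDerivAt_shift (hT : IsTransformation O φ ξ η t X χ) (hx : x ∈ O) :
    HasDerivAt (fun s => (s, X s x)) (1, ξ x) 0 :=
  (hasDerivAt_id 0).prodMk (hT.deriv_X x hx)

/-- Differentiating χ_s(X_s(x)) at s = 0 gives η = ∂_s χ + ∂φ · ξ. So the derivative at a fixed
point is the variation δ̄φ. -/
lemma fderiv_χ_param (hT : IsTransformation O φ ξ η t X χ) (hO : IsOpen O) (hx : x ∈ O) :
    fderiv ℝ (fun p : ℝ × Spacetime n => χ p.1 p.2) (0, x) (1, 0)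
      = η x - fderiv ℝ φ x (ξ x) := by
  have h1 := (hT.differentiableAt_χ hO (hT.zero_mem hx)).hasFDerivAt.comp_hasDerivAt_of_eq (0 : ℝ)
    (hT.hasDerivAt_shift hx) (by rw [hT.X_zero x hx])
  have h2 := h1.unique (hT.deriv_χ x hx)
  have h3 : ((1 : ℝ), ξ x) = (1, 0) + (0, ξ x) := by simp
  rw [h3, map_add, hT.fderiv_χ_zero hO hx] at h2
  rw [← h2, add_sub_cancel_right]

/-- The velocity components of the jet of the transformed field. -/
lemma jet_eq (hT : IsTransformation O φ ξ η t X χ) (hO : IsOpen O) {s : ℝ} {y : Spacetime n}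
    (hp : (s, y) ∈ Ioo (-t) t ×ˢ O) :
    jet (χ s) y = (y, χ s y, fun a μ =>
      fderiv ℝ (fun p : ℝ × Spacetime n => χ p.1 p.2) (s, y) (0, Pi.single μ 1) a) := by
  have hd := hT.differentiableAt_χ hO hp
  have hdy : DifferentiableAt ℝ (χ s) y :=
    (hd.hasFDerivAt.comp y (hasFDerivAt_prodMk_right s y)).differentiableAt
  simp only [jet, pd_eq_of_comp hdy, fderiv_slice hd]

lemma pd_bar (hT : IsTransformation O φ ξ η t X χ) (hO : IsOpen O) (hφ : ContDiffOn ℝ ∞ φ O)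
    (hξ : ContDiffOn ℝ ∞ ξ O) (hη : ContDiffOn ℝ ∞ η O) (hx : x ∈ O) (a : Fin N)
    (μ : Fin (n + 1)) :
    fderiv ℝ (fun y => fderiv ℝ (fun p : ℝ × Spacetime n => χ p.1 p.2) (0, y) (1, 0)) x
        (Pi.single μ 1) a
      = pd μ (fun y => η y a) x - ∑ ν, (pd μ (pd ν (fun y => φ y a)) x * ξ x ν
        + pd ν (fun y => φ y a) x * pd μ (fun y => ξ y ν) x) := by
  have hd : DifferentiableAt ℝ
      (fun y => fderiv ℝ (fun p : ℝ × Spacetime n => χ p.1 p.2) (0, y) (1, 0)) x := by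
    have := ContDiffOn.differentiableAt_of_isOpen (contDiffOn_fderiv_const hT.smooth_χ
      (isOpen_Ioo.prod hO) (1, 0)) (isOpen_Ioo.prod hO) (hT.zero_mem hx)
    exact (this.hasFDerivAt.comp x (hasFDerivAt_prodMk_right (0 : ℝ) x)).differentiableAt
  have he : (fun y => fderiv ℝ (fun p : ℝ × Spacetime n => χ p.1 p.2) (0, y) (1, 0) a) =ᶠ[𝓝 x]
      fun y => η y a - ∑ ν, pd ν (fun y => φ y a) y * ξ y ν :=
    (hO.eventually_mem hx).mono fun y hy => by
      have hφd := ContDiffOn.differentiableAt_of_isOpen hφ hO hy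
      simp only [hT.fderiv_χ_param hO hy, Pi.sub_apply]
      have : fderiv ℝ φ y (ξ y) a = fderiv ℝ (fun y => φ y a) y (ξ y) := by
        rw [fderiv_apply hφd]
        rfl
      rw [this, fderiv_apply_eq_sum_pd]
      simp only [mul_comm]
  have dξ : ∀ μ, DifferentiableAt ℝ (fun y => ξ y μ) x := fun μ =>
    ContDiffOn.differentiableAt_of_isOpen (contDiffOn_pi.1 hξ μ) hO hx
  have dη : DifferentiableAt ℝ (fun y => η y a) x :=
    ContDiffOn.differentiableAt_of_isOpen (contDiffOn_pi.1 hη a) hO hx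
  have dφ : ∀ μ, DifferentiableAt ℝ (pd μ (fun y => φ y a)) x := fun μ =>
    ContDiffOn.differentiableAt_of_isOpen (contDiffOn_pd hO (contDiffOn_pi.1 hφ a) μ) hO hx
  rw [← pd_eq_of_comp hd a μ, pd_congr he,
    pd_sub dη (DifferentiableAt.fun_sum fun ν _ => (dφ ν).fun_mul (dξ ν)),
    pd_sum fun ν _ => (dφ ν).fun_mul (dξ ν)]
  simp only [pd_mul (dφ _) (dξ _)]

/-- The substitution y ↦ X_s(y) turns the transformed action into an integral over the fixed set K
of 𝓛 at the transformed jet times the Jacobian. Its value is constant for small s. Differentiating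
under the integral, the jet contributes δ𝓛 and the Jacobian contributes 𝓛 ∂_μ δx^μ. -/
lemma setIntegral_variation_eq_zero (hT : IsTransformation O φ ξ η t X χ) (hJ : IsOpen J)
    {ℒ : Jet n N → ℝ} (hℒ : ContDiffOn ℝ ∞ ℒ J) (h : IsLocalField J O φ)
    (hξ : ContDiffOn ℝ ∞ ξ O) (hη : ContDiffOn ℝ ∞ η O) {K : Set (Spacetime n)}
    (hK : IsCompact K) (hKO : K ⊆ O)
    (hact : ∀ᶠ s in 𝓝 (0 : ℝ), action ℒ (X s '' K) (χ s) = action ℒ K φ) :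
    ∫ x in K, (∑ a, dField ℒ a (jet φ x) * η x a
      + ∑ a, ∑ ν, dVel ℒ a ν (jet φ x) * (pd ν (fun y => η y a) x
          - ∑ μ, pd μ (fun y => φ y a) x * pd ν (fun y => ξ y μ) x)
      + ∑ μ, dX ℒ μ (jet φ x) * ξ x μ
      + ℒ (jet φ x) * ∑ μ, pd μ (fun y => ξ y μ) x) = 0 := by
  have hO := h.1
  set Xf : ℝ × Spacetime n → Spacetime n := fun p => X p.1 p.2 with hXf
  set Φ : ℝ × Spacetime n → Target N := fun p => χ p.1 p.2 with hΦ
  set U : Set (ℝ × Spacetime n) := Ioo (-t) t ×ˢ O with hUdef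
  have hU : IsOpen U := isOpen_Ioo.prod hO
  have sX : ContDiffOn ℝ ∞ Xf U := hT.smooth_X
  have sΦ : ContDiffOn ℝ ∞ Φ U := hT.smooth_χ
  let sh : ℝ × Spacetime n → ℝ × Spacetime n := fun p => (p.1, Xf p)
  have ssh : ContDiffOn ℝ ∞ sh U := contDiff_fst.contDiffOn.prodMk sX
  let P : Fin (n + 1) → ℝ × Spacetime n → Target N := fun μ p => fderiv ℝ Φ p (0, Pi.single μ 1)
  have sP : ∀ μ, ContDiffOn ℝ ∞ (P μ) U := fun μ => contDiffOn_fderiv_const sΦ hU _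
  -- The shifted point X_s(y) must still lie in O, where χ_s is controlled.
  let U₁ : Set (ℝ × Spacetime n) := U ∩ sh ⁻¹' U
  have hU₁ : IsOpen U₁ := ssh.continuousOn.isOpen_inter_preimage hU hU
  have ssh₁ : ContDiffOn ℝ ∞ sh U₁ := ssh.mono inter_subset_left
  have hmaps : MapsTo sh U₁ U := fun p hp => hp.2
  -- The jet of χ_s at X_s(y), written with joint derivatives in (s, y) so that its smoothness in
  -- both variables is visible.
  let Jt : ℝ × Spacetime n → Jet n N := fun p => (Xf p, Φ (sh p), fun a μ => P μ (sh p) a)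
  have sJt : ContDiffOn ℝ ∞ Jt U₁ := (sX.mono inter_subset_left).prodMk
    ((sΦ.comp ssh₁ hmaps).prodMk (contDiffOn_pi.2 fun a => contDiffOn_pi.2 fun μ =>
      contDiffOn_pi.1 ((sP μ).comp ssh₁ hmaps) a))
  let M : ℝ × Spacetime n → Fin (n + 1) → Fin (n + 1) → ℝ := fun p i k =>
    fderiv ℝ Xf p (0, Pi.single k 1) i
  have sM : ContDiffOn ℝ ∞ M U := contDiffOn_pi.2 fun i => contDiffOn_pi.2 fun k =>
    contDiffOn_pi.1 (contDiffOn_fderiv_const sX hU (0, Pi.single k 1)) i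
  let Δ : ℝ × Spacetime n → ℝ := fun p => (Matrix.of (M p)).det
  have sΔ : ContDiffOn ℝ ∞ Δ U := (contDiff_det (n + 1)).comp_contDiffOn sM
  -- On Ω the transformed jet stays in J, and positivity of the Jacobian removes the absolute value
  -- from the change of variables.
  let Ω : Set (ℝ × Spacetime n) := U₁ ∩ (fun p => (Jt p, Δ p)) ⁻¹' (J ×ˢ Ioi 0)
  have hΩ : IsOpen Ω := (sJt.continuousOn.prodMk
    (sΔ.continuousOn.mono inter_subset_left)).isOpen_inter_preimage hU₁ (hJ.prod isOpen_Ioi)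
  let G : ℝ × Spacetime n → ℝ := fun p => ℒ (Jt p) * Δ p
  have sG : ContDiffOn ℝ ∞ G Ω :=
    (hℒ.comp (sJt.mono inter_subset_left) fun p hp => hp.2.1).mul
      (sΔ.mono (inter_subset_left.trans inter_subset_left))
  have hJt : ∀ p ∈ U₁, jet (χ p.1) (Xf p) = Jt p := fun p hp => hT.jet_eq hO hp.2
  have hsh0 : ∀ y ∈ O, sh (0, y) = (0, y) := fun y hy => by
    simp only [sh, hXf, hT.X_zero y hy]
  have hU₁0 : ∀ y ∈ O, ((0 : ℝ), y) ∈ U₁ := fun y hy =>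
    ⟨hT.zero_mem hy, by rw [mem_preimage, hsh0 y hy]; exact hT.zero_mem hy⟩
  have hJt0 : ∀ y ∈ O, Jt (0, y) = jet φ y := fun y hy => by
    rw [← hJt (0, y) (hU₁0 y hy)]
    have he : χ 0 =ᶠ[𝓝 y] φ := (hO.eventually_mem hy).mono hT.χ_zero
    simp only [hXf, hT.X_zero y hy, jet, he.eq_of_nhds]
    congr 2
    ext a μ
    exact pd_congr (he.mono fun z hz => by rw [hz]) μ
  have hM0 : ∀ y ∈ O, Matrix.of (M (0, y)) = 1 := fun y hy => by
    ext i k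
    simp only [M, Matrix.of_apply, hXf, hT.fderiv_X_zero hO hy]
    simp [Matrix.one_apply, Pi.single_apply]
  have hΔ0 : ∀ y ∈ O, Δ (0, y) = 1 := fun y hy => by simp only [Δ, hM0 y hy, Matrix.det_one]
  have hΩ0 : ∀ y ∈ O, ((0 : ℝ), y) ∈ Ω := fun y hy =>
    ⟨hU₁0 y hy, by simpa [hJt0 y hy] using h.2.2 y hy, by simp [hΔ0 y hy]⟩
  have hI : ∀ᶠ s in 𝓝 (0 : ℝ), action ℒ (X s '' K) (χ s) = ∫ y in K, G (s, y) := by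
    filter_upwards [eventually_forall_mem_of_isCompact hΩ hK fun y hy => hΩ0 y (hKO hy),
      Ioo_mem_nhds (neg_lt_zero.2 hT.pos) hT.pos] with s hs hst
    have hder : ∀ y ∈ K, HasFDerivWithinAt (X s) (fderiv ℝ (X s) y) K y := fun y hy => by
      have hd := hT.differentiableAt_X hO (hs y hy).1.1
      exact (hd.hasFDerivAt.comp y
        (hasFDerivAt_prodMk_right s y)).differentiableAt.hasFDerivAt.hasFDerivWithinAt
    rw [action, integral_image_eq_integral_abs_det_fderiv_smul volume hK.measurableSet hder
      ((hT.injOn s hst).mono hKO)]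
    refine setIntegral_congr_fun hK.measurableSet fun y hy => ?_
    have hdet : (fderiv ℝ (X s) y).det = Δ (s, y) := by
      rw [ContinuousLinearMap.det, ← LinearMap.det_toMatrix']
      congr 1
      ext i k
      rw [LinearMap.toMatrix'_apply]
      simp only [Matrix.of_apply, M]
      rw [← fderiv_slice (hT.differentiableAt_X hO (hs y hy).1.1)]
      congr 2
    have hpos : 0 < Δ (s, y) := (hs y hy).2.2
    simp only [hdet, abs_of_pos hpos, smul_eq_mul, G]
    rw [← hJt (s, y) (hs y hy).1, mul_comm]
  have h0 : HasDerivAt (fun s => ∫ y in K, G (s, y)) 0 0 :=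
    (hasDerivAt_const (0 : ℝ) (action ℒ K φ)).congr_of_eventuallyEq
      ((hI.and hact).mono fun s hs => hs.1.symm.trans hs.2)
  rw [← (hasDerivAt_setIntegral_of_contDiffOn hΩ sG hK fun y hy => hΩ0 y (hKO hy)).unique h0]
  refine setIntegral_congr_fun hK.measurableSet fun x hxK => ?_
  have hx := hKO hxK
  have dG := (ContDiffOn.differentiableAt_of_isOpen sG hΩ (hΩ0 x hx)).hasFDerivAt
  have hl : HasDerivAt (fun s : ℝ => (s, x)) ((1 : ℝ), (0 : Spacetime n)) 0 :=
    (hasDerivAt_id 0).prodMk (hasDerivAt_const 0 x)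
  have hG1 := dG.comp_hasDerivAt (0 : ℝ) hl
  have hMd : HasDerivAt (fun s => M (s, x)) (fun i k => pd k (fun y => ξ y i) x) 0 := by
    refine hasDerivAt_pi.2 fun i => hasDerivAt_pi.2 fun k => ?_
    have hd := (ContDiffOn.differentiableAt_of_isOpen (contDiffOn_fderiv_const sX hU
      (0, Pi.single k 1)) hU (hT.zero_mem hx)).hasFDerivAt.comp_hasDerivAt (0 : ℝ) hl
    rw [fderiv_param_fderiv_space hU sX (hT.zero_mem hx)] at hd
    have he : (fun y => fderiv ℝ Xf (0, y) (1, 0)) =ᶠ[𝓝 x] ξ :=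
      (hO.eventually_mem hx).mono fun y hy => hT.fderiv_X_param hO hy
    rw [he.fderiv_eq] at hd
    rw [pd_eq_of_comp (φ := ξ) (ContDiffOn.differentiableAt_of_isOpen hξ hO hx)]
    exact hasDerivAt_pi.1 hd i
  have hΔd : HasDerivAt (fun s => Δ (s, x)) (∑ i, pd i (fun y => ξ y i) x) 0 :=
    hasDerivAt_det_of_eq_one (hM0 x hx) hMd
  have hPd : ∀ a μ, HasDerivAt (fun s => P μ (sh (s, x)) a) (pd μ (fun y => η y a) x
      - ∑ ν, pd ν (fun y => φ y a) x * pd μ (fun y => ξ y ν) x) 0 := by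
    intro a μ
    have dP := (ContDiffOn.differentiableAt_of_isOpen (sP μ) hU (hT.zero_mem hx)).hasFDerivAt
    have hd := dP.comp_hasDerivAt_of_eq (0 : ℝ) (hT.hasDerivAt_shift hx) (hsh0 x hx).symm
    have hsplit : ((1 : ℝ), ξ x) = (1, 0) + (0, ξ x) := by simp
    have hspace : fderiv ℝ (P μ) (0, x) (0, ξ x) a
        = ∑ ν, ξ x ν * pd ν (pd μ (fun y => φ y a)) x := by
      rw [← fderiv_apply_eq_sum_pd]
      have hc := (hasFDerivAt_pi'.1 (dP.comp x (hasFDerivAt_prodMk_right (0 : ℝ) x)) a).fderiv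
      have he : (fun y => P μ (0, y) a) =ᶠ[𝓝 x] pd μ (fun y => φ y a) :=
        (hO.eventually_mem hx).mono fun y hy => by
          simp only [P]
          rw [hT.fderiv_χ_zero hO hy,
            pd_eq_of_comp (ContDiffOn.differentiableAt_of_isOpen h.2.1 hO hy)]
      rw [← he.fderiv_eq]
      change _ = fderiv ℝ (fun y => (P μ ∘ Prod.mk 0) y a) x (ξ x)
      rw [hc]
      rfl
    rw [hsplit, map_add, fderiv_param_fderiv_space hU sΦ (hT.zero_mem hx)] at hd
    have hda := hasDerivAt_pi.1 hd a
    refine hda.congr_deriv ?_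
    rw [Pi.add_apply, hspace, hT.pd_bar hO h.2.1 hξ hη hx a μ, Finset.sum_add_distrib]
    -- The shift of the base point contributes ξ^ν ∂_ν ∂_μ φ, which cancels the same term in ∂_μ
    -- δ̄φ. What remains is δ(∂_μ φ) = ∂_μ η - ∂_ν φ ∂_μ ξ^ν.
    have hsw : ∑ ν, ξ x ν * pd ν (pd μ (fun y => φ y a)) x
        = ∑ ν, pd μ (pd ν (fun y => φ y a)) x * ξ x ν := Finset.sum_congr rfl fun ν _ => by
      rw [pd_comm hO (h.contDiffOn_comp a) hx ν μ, mul_comm]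
    rw [hsw]
    ring
  have hJd : HasDerivAt (fun s => Jt (s, x)) (ξ x, η x, fun a μ => pd μ (fun y => η y a) x
      - ∑ ν, pd ν (fun y => φ y a) x * pd μ (fun y => ξ y ν) x) 0 :=
    (hT.deriv_X x hx).prodMk ((hT.deriv_χ x hx).prodMk
      (hasDerivAt_pi.2 fun a => hasDerivAt_pi.2 fun μ => hPd a μ))
  have hLd := (ContDiffOn.differentiableAt_of_isOpen hℒ hJ
    (h.2.2 x hx)).hasFDerivAt.comp_hasDerivAt_of_eq (0 : ℝ) hJd (hJt0 x hx).symm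
  have hG2 := hLd.fun_mul hΔd
  have hfin := hG1.unique hG2
  simp only [Function.comp_apply, hΔ0 x hx, hJt0 x hx, mul_one] at hfin
  rw [hfin, fderiv_jet_apply]
  simp only [mul_comm (dX _ _ _), mul_comm (dField _ _ _), mul_comm (dVel _ _ _ _)]
  ring

end IsTransformation

variable {ℒ : Jet n N → ℝ} {D : Descriptors n N r} {ε : Spacetime n → Fin r → ℝ}

/-! ### Local transformations along a field -/

/-- A function smooth near K and zero off K is globally smooth with compact support. Integrating its
derivative by parts against the constant 1 then gives zero. -/
lemma setIntegral_pd_eq_zero {f : Spacetime n → ℝ} {K : Set (Spacetime n)} (hO : IsOpen O)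
    (hf : ContDiffOn ℝ ∞ f O) (hK : IsCompact K) (hKO : K ⊆ O) (h0 : ∀ y ∉ K, f y = 0)
    (μ : Fin (n + 1)) : ∫ x in K, pd μ f x = 0 := by
  have hev : ∀ y ∉ K, f =ᶠ[𝓝 y] fun _ => 0 := fun y hy =>
    (hK.isClosed.isOpen_compl.eventually_mem hy).mono h0
  have hs : ContDiff ℝ ∞ f := contDiff_iff_contDiffAt.2 fun y => by
    by_cases hy : y ∈ K
    · exact hf.contDiffAt (hO.mem_nhds (hKO hy))
    · exact contDiffAt_const.congr_of_eventuallyEq (hev y hy)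
  have hcs : HasCompactSupport f := HasCompactSupport.intro hK h0
  have hfi : Integrable f := hs.continuous.integrable_of_hasCompactSupport hcs
  have hdi : Integrable (fun y => fderiv ℝ f y (Pi.single μ 1)) :=
    ((hs.continuous_fderiv (by simp)).clm_apply
      continuous_const).integrable_of_hasCompactSupport (hcs.fderiv_apply ℝ _)
  rw [setIntegral_eq_integral_of_forall_compl_eq_zero fun y hy => by
    rw [pd_congr (hev y hy), pd_const]]
  have := integral_mul_fderiv_eq_neg_fderiv_mul_of_integrable (μ := volume)
    (f := fun _ : Spacetime n => (1 : ℝ)) (g := f) (v := Pi.single μ 1)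
    (by simp) (by simpa using hdi) (by simpa using hfi) (by simp)
    (fun y _ => hs.differentiable (by simp) y)
  simpa [pd] using this

namespace Descriptors

lemma SmoothOn.contDiffOn_BA (hD : D.SmoothOn J) (α : Fin r) (a : Fin N) :
    ContDiffOn ℝ ∞ (D.BA α a) J :=
  (hD.2.1 α a).sub (ContDiffOn.sum fun μ _ =>
    (contDiff_jet_velocity a μ).contDiffOn.mul (hD.1 α μ))

lemma SmoothOn.contDiffOn_deltaX (hD : D.SmoothOn J) (h : IsLocalField J O φ)
    (hε : ContDiffOn ℝ ∞ ε O) : ContDiffOn ℝ ∞ (D.deltaX ε φ) O :=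
  contDiffOn_pi.2 fun μ => ContDiffOn.sum fun α _ =>
    (contDiffOn_pi.1 hε α).mul (h.contDiffOn_along (hD.1 α μ))

lemma SmoothOn.contDiffOn_deltaField (hD : D.SmoothOn J) (h : IsLocalField J O φ)
    (hε : ContDiffOn ℝ ∞ ε O) : ContDiffOn ℝ ∞ (D.deltaField ε φ) O :=
  contDiffOn_pi.2 fun a => (ContDiffOn.sum fun α _ =>
    (contDiffOn_pi.1 hε α).mul (h.contDiffOn_along (hD.2.1 α a))).add
    (ContDiffOn.sum fun α _ => ContDiffOn.sum fun μ _ =>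
      (contDiffOn_pd h.1 (contDiffOn_pi.1 hε α) μ).mul (h.contDiffOn_along (hD.2.2 α a μ)))

lemma SmoothOn.contDiffOn_deltaBar (hD : D.SmoothOn J) (h : IsLocalField J O φ)
    (hε : ContDiffOn ℝ ∞ ε O) : ContDiffOn ℝ ∞ (D.deltaBar ε φ) O :=
  contDiffOn_pi.2 fun a => (contDiffOn_pi.1 (hD.contDiffOn_deltaField h hε) a).sub
    (ContDiffOn.sum fun μ _ => (h.contDiffOn_pd a μ).mul
      (contDiffOn_pi.1 (hD.contDiffOn_deltaX h hε) μ))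

lemma deltaBar_eq (D : Descriptors n N r) (ε : Spacetime n → Fin r → ℝ)
    (φ : Spacetime n → Target N) (x : Spacetime n) (a : Fin N) :
    D.deltaBar ε φ x a = ∑ α, ε x α * D.BA α a (jet φ x)
      + ∑ α, ∑ μ, pd μ (fun y => ε y α) x * D.C α a μ (jet φ x) := by
  have hc : ∑ μ, pd μ (fun y => φ y a) x * ∑ α, ε x α * D.A α μ (jet φ x)
      = ∑ α, ε x α * ∑ μ, (jet φ x).2.2 a μ * D.A α μ (jet φ x) := by
    simp only [Finset.mul_sum]
    rw [Finset.sum_comm]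
    refine Finset.sum_congr rfl fun α _ => Finset.sum_congr rfl fun μ _ => ?_
    simp only [jet]
    ring
  simp only [deltaBar, deltaField, deltaX, BA, mul_sub, Finset.sum_sub_distrib]
  rw [hc]
  ring

lemma deltaX_eq_zero (hx : x ∉ tsupport ε) : D.deltaX ε φ x = 0 := by
  ext μ
  simp [deltaX, image_eq_zero_of_notMem_tsupport hx]

lemma deltaBar_eq_zero (hx : x ∉ tsupport ε) : D.deltaBar ε φ x = 0 := by
  -- Off the closed support ε vanishes on a whole neighbourhood, so its derivatives vanish too.
  have hp : ∀ α μ, pd μ (fun y => ε y α) x = 0 := fun α μ => by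
    rw [pd_congr (g := fun _ => 0) ((notMem_tsupport_iff_eventuallyEq.1 hx).mono fun y hy => by
      rw [hy]; rfl), pd_const]
  ext a
  simp [deltaBar_eq, hp, image_eq_zero_of_notMem_tsupport hx]

/-- The left-hand side `L_a (B^{αa} - ∂_μ φ^a A^{αμ}) - ∂_μ (L_a C^{αaμ})` of the identities
between the Euler derivatives. -/
noncomputable def eulerIdentity (D : Descriptors n N r) (ℒ : Jet n N → ℝ)
    (φ : Spacetime n → Target N) (α : Fin r) (x : Spacetime n) : ℝ :=
  ∑ a, euler ℒ φ a x * D.BA α a (jet φ x)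
    - ∑ μ, pd μ (fun y => ∑ a, euler ℒ φ a y * D.C α a μ (jet φ y)) x

lemma contDiffOn_euler_mul_C (hJ : IsOpen J) (hℒ : ContDiffOn ℝ ∞ ℒ J) (hD : D.SmoothOn J)
    (h : IsLocalField J O φ) (α : Fin r) (μ : Fin (n + 1)) :
    ContDiffOn ℝ ∞ (fun y => ∑ a, euler ℒ φ a y * D.C α a μ (jet φ y)) O :=
  ContDiffOn.sum fun a _ => (h.contDiffOn_euler hJ hℒ a).mul (h.contDiffOn_along (hD.2.2 α a μ))

lemma contDiffOn_eulerIdentity (hJ : IsOpen J) (hℒ : ContDiffOn ℝ ∞ ℒ J) (hD : D.SmoothOn J)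
    (h : IsLocalField J O φ) (α : Fin r) : ContDiffOn ℝ ∞ (D.eulerIdentity ℒ φ α) O :=
  (ContDiffOn.sum fun a _ =>
    (h.contDiffOn_euler hJ hℒ a).mul (h.contDiffOn_along (hD.contDiffOn_BA α a))).sub
  (ContDiffOn.sum fun μ _ => contDiffOn_pd h.1 (contDiffOn_euler_mul_C hJ hℒ hD h α μ) μ)

/-- Integration by parts before integrating: ∂_μ ε_α L_a C^{αaμ} = ∂_μ(ε_α L_a C^{αaμ}) - ε_α
∂_μ(L_a C^{αaμ}), after which ε appears undifferentiated outside the divergence. -/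
lemma euler_mul_deltaBar (hJ : IsOpen J) (hℒ : ContDiffOn ℝ ∞ ℒ J) (hD : D.SmoothOn J)
    (h : IsLocalField J O φ) (hε : ContDiffOn ℝ ∞ ε O) (hx : x ∈ O) :
    ∑ a, euler ℒ φ a x * D.deltaBar ε φ x a
      = ∑ μ, pd μ (fun y => ∑ α, ε y α * ∑ a, euler ℒ φ a y * D.C α a μ (jet φ y)) x
        + ∑ α, ε x α * D.eulerIdentity ℒ φ α x := by
  have dε : ∀ α, DifferentiableAt ℝ (fun y => ε y α) x := fun α =>
    ContDiffOn.differentiableAt_of_isOpen (contDiffOn_pi.1 hε α) h.1 hx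
  have dC : ∀ α μ, DifferentiableAt ℝ (fun y => ∑ a, euler ℒ φ a y * D.C α a μ (jet φ y)) x :=
    fun α μ => ContDiffOn.differentiableAt_of_isOpen (contDiffOn_euler_mul_C hJ hℒ hD h α μ) h.1 hx
  have hp : ∀ μ, pd μ (fun y => ∑ α, ε y α * ∑ a, euler ℒ φ a y * D.C α a μ (jet φ y)) x
      = ∑ α, (pd μ (fun y => ε y α) x * ∑ a, euler ℒ φ a x * D.C α a μ (jet φ x)
        + ε x α * pd μ (fun y => ∑ a, euler ℒ φ a y * D.C α a μ (jet φ y)) x) := fun μ => by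
    rw [pd_sum fun α _ => (dε α).fun_mul (dC α μ)]
    exact Finset.sum_congr rfl fun α _ => pd_mul (dε α) (dC α μ) μ
  have e1 : ∑ a, euler ℒ φ a x * ∑ α, ε x α * D.BA α a (jet φ x)
      = ∑ α, ε x α * ∑ a, euler ℒ φ a x * D.BA α a (jet φ x) := by
    simp only [Finset.mul_sum]
    rw [Finset.sum_comm]
    exact Finset.sum_congr rfl fun α _ => Finset.sum_congr rfl fun a _ => by ring
  have e2 : ∑ a, euler ℒ φ a x * ∑ α, ∑ μ, pd μ (fun y => ε y α) x * D.C α a μ (jet φ x)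
      = ∑ μ, ∑ α, pd μ (fun y => ε y α) x * ∑ a, euler ℒ φ a x * D.C α a μ (jet φ x) := by
    simp only [Finset.mul_sum]
    rw [Finset.sum_comm, Finset.sum_comm (γ := Fin (n + 1))]
    refine Finset.sum_congr rfl fun α _ => ?_
    rw [Finset.sum_comm]
    exact Finset.sum_congr rfl fun μ _ => Finset.sum_congr rfl fun a _ => by ring
  have e3 : ∑ α, ε x α * ∑ μ, pd μ (fun y => ∑ a, euler ℒ φ a y * D.C α a μ (jet φ y)) x
      = ∑ μ, ∑ α, ε x α * pd μ (fun y => ∑ a, euler ℒ φ a y * D.C α a μ (jet φ y)) x := by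
    simp only [Finset.mul_sum]
    rw [Finset.sum_comm]
  simp only [deltaBar_eq, mul_add, Finset.sum_add_distrib, hp, eulerIdentity, mul_sub,
    Finset.sum_sub_distrib, e1, e2, e3]
  ring

/-- The current `𝓛 δx^μ + ∂𝓛/∂(∂_μ φ^a) δ̄φ^a`. -/
noncomputable def noetherCurrent (D : Descriptors n N r) (ℒ : Jet n N → ℝ)
    (ε : Spacetime n → Fin r → ℝ) (φ : Spacetime n → Target N) (μ : Fin (n + 1))
    (y : Spacetime n) : ℝ :=
  ℒ (jet φ y) * D.deltaX ε φ y μ + ∑ a, dVel ℒ a μ (jet φ y) * D.deltaBar ε φ y a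

lemma contDiffOn_noetherCurrent (hJ : IsOpen J) (hℒ : ContDiffOn ℝ ∞ ℒ J) (hD : D.SmoothOn J)
    (h : IsLocalField J O φ) (hε : ContDiffOn ℝ ∞ ε O) (μ : Fin (n + 1)) :
    ContDiffOn ℝ ∞ (D.noetherCurrent ℒ ε φ μ) O :=
  ((h.contDiffOn_along hℒ).mul (contDiffOn_pi.1 (hD.contDiffOn_deltaX h hε) μ)).add
    (ContDiffOn.sum fun a _ => (h.contDiffOn_along (contDiffOn_dVel hJ hℒ a μ)).mul
      (contDiffOn_pi.1 (hD.contDiffOn_deltaBar h hε) a))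

lemma deltaLagrangian_eq (hJ : IsOpen J) (hℒ : ContDiffOn ℝ ∞ ℒ J) (hD : D.SmoothOn J)
    (h : IsLocalField J O φ) (hε : ContDiffOn ℝ ∞ ε O) (hx : x ∈ O) :
    D.deltaLagrangian ℒ ε φ x + ℒ (jet φ x) * ∑ μ, pd μ (fun y => D.deltaX ε φ y μ) x
      = ∑ μ, pd μ (D.noetherCurrent ℒ ε φ μ) x + ∑ a, euler ℒ φ a x * D.deltaBar ε φ x a :=
  variation_eq_divergence hJ hℒ h (hD.contDiffOn_deltaX h hε) (hD.contDiffOn_deltaField h hε)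
    (fun _ _ => rfl) hx

/-- Noether's second theorem. -/
theorem eulerIdentity_eq_zero (hJ : IsOpen J) (hℒ : ContDiffOn ℝ ∞ ℒ J) (hD : D.SmoothOn J)
    (hinv : ActionInvariant J ℒ D) (h : IsLocalField J O φ) (hx : x ∈ O) (α : Fin r) :
    D.eulerIdentity ℒ φ α x = 0 := by
  have hcont := (contDiffOn_eulerIdentity hJ hℒ hD h α).continuousOn
  -- The fundamental lemma of the calculus of variations gives vanishing almost everywhere;
  -- continuity upgrades it at the end.
  have hae : ∀ᵐ y, y ∈ O → D.eulerIdentity ℒ φ α y = 0 := by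
    refine h.1.ae_eq_zero_of_integral_contDiff_smul_eq_zero
      (hcont.locallyIntegrableOn h.1.measurableSet) fun g hg hgc hgO => ?_
    -- A parameter with the test function in the slot α alone isolates one identity.
    set ε : Spacetime n → Fin r → ℝ := fun y => Pi.single α (g y) with hεdef
    have hε : ContDiff ℝ ∞ ε := contDiff_pi.2 fun β => by
      by_cases hβ : β = α
      · subst hβ
        simpa [hεdef] using hg
      · simpa [hεdef, hβ] using contDiff_const
    have hsupp : tsupport ε ⊆ tsupport g := closure_mono fun y hy hgy => hy (by
      simp only [hεdef, hgy, Pi.single_zero])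
    obtain ⟨t, X, χ, hT, hact⟩ := hinv O φ h ε hε
      (hgc.of_isClosed_subset (isClosed_tsupport ε) hsupp) (hsupp.trans hgO)
    set K := tsupport g with hKdef
    have hK : IsCompact K := hgc
    have hε' := hε.contDiffOn (s := O)
    have hvar := hT.setIntegral_variation_eq_zero hJ hℒ h (hD.contDiffOn_deltaX h hε')
      (hD.contDiffOn_deltaField h hε') hK hgO (hact K hK hsupp hgO)
    have sQ : ∀ μ, ContDiffOn ℝ ∞
        (fun y => ∑ β, ε y β * ∑ a, euler ℒ φ a y * D.C β a μ (jet φ y)) O := fun μ =>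
      ContDiffOn.sum fun β _ => (contDiffOn_pi.1 hε' β).mul
        (contDiffOn_euler_mul_C hJ hℒ hD h β μ)
    have sN := fun μ => contDiffOn_noetherCurrent hJ hℒ hD h hε' μ
    have hint : ∀ f : Spacetime n → ℝ, ContDiffOn ℝ ∞ f O → ∀ μ, IntegrableOn (pd μ f) K :=
      fun f hf μ => ((contDiffOn_pd h.1 hf μ).continuousOn.mono hgO).integrableOn_compact hK
    have hpt : ∀ y ∈ K, D.deltaLagrangian ℒ ε φ y
          + ℒ (jet φ y) * ∑ μ, pd μ (fun y => D.deltaX ε φ y μ) y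
        = ∑ μ, pd μ (D.noetherCurrent ℒ ε φ μ) y
          + ∑ μ, pd μ (fun y => ∑ β, ε y β * ∑ a, euler ℒ φ a y * D.C β a μ (jet φ y)) y
          + g y * D.eulerIdentity ℒ φ α y := fun y hy => by
      rw [deltaLagrangian_eq hJ hℒ hD h hε' (hgO hy),
        euler_mul_deltaBar hJ hℒ hD h hε' (hgO hy), ← add_assoc]
      congr 1
      rw [Finset.sum_eq_single α (fun β _ hβ => by simp [hεdef, hβ]) (by simp)]
      simp [hεdef]
    have hi1 : IntegrableOn (fun y => ∑ μ, pd μ (D.noetherCurrent ℒ ε φ μ) y) K :=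
      integrable_finsetSum _ fun μ _ => hint _ (sN μ) μ
    have hi2 : IntegrableOn (fun y =>
        ∑ μ, pd μ (fun y => ∑ β, ε y β * ∑ a, euler ℒ φ a y * D.C β a μ (jet φ y)) y) K :=
      integrable_finsetSum _ fun μ _ => hint _ (sQ μ) μ
    have hi3 : IntegrableOn (fun y => g y * D.eulerIdentity ℒ φ α y) K :=
      (hg.continuous.continuousOn.mul (hcont.mono hgO)).integrableOn_compact hK
    have hvar' : ∫ y in K, (D.deltaLagrangian ℒ ε φ y
        + ℒ (jet φ y) * ∑ μ, pd μ (fun y => D.deltaX ε φ y μ) y) = 0 := hvar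
    rw [setIntegral_congr_fun hK.measurableSet hpt, integral_add (Integrable.fun_add hi1 hi2) hi3,
      integral_add hi1 hi2, integral_finsetSum _ fun μ _ => hint _ (sN μ) μ,
      integral_finsetSum _ fun μ _ => hint _ (sQ μ) μ,
      Finset.sum_eq_zero fun μ _ => setIntegral_pd_eq_zero h.1 (sN μ) hK hgO (fun y hy => by
        simp [noetherCurrent, deltaX_eq_zero fun hy' => hy (hsupp hy'),
          deltaBar_eq_zero fun hy' => hy (hsupp hy')]) μ,
      Finset.sum_eq_zero fun μ _ => setIntegral_pd_eq_zero h.1 (sQ μ) hK hgO (fun y hy => by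
        simp [image_eq_zero_of_notMem_tsupport fun hy' => hy (hsupp hy')]) μ,
      zero_add, zero_add] at hvar'
    rw [← hvar', setIntegral_eq_integral_of_forall_compl_eq_zero fun y hy => by
      simp [image_eq_zero_of_notMem_tsupport hy]]
    rfl
  exact Measure.eqOn_open_of_ae_eq (μ := volume) (f := D.eulerIdentity ℒ φ α) (g := fun _ => 0)
    ((ae_restrict_iff' h.1.measurableSet).2 hae) h.1 hcont continuousOn_const hx

end Descriptors

/-! ### The local current -/

/-- The Euler derivative as a function of the second-order jet. -/
noncomputable def eulerJet (ℒ : Jet n N → ℝ) (a : Fin N) (k : Jet2 n N) : ℝ :=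
  -(∑ μ, ∑ ν, ∑ b, W ℒ μ ν a b k.1 * k.2 b μ ν) + V ℒ a k.1

lemma contDiffOn_eulerJet (hJ : IsOpen J) (hℒ : ContDiffOn ℝ ∞ ℒ J) (a : Fin N) :
    ContDiffOn ℝ ∞ (eulerJet ℒ a) (J ×ˢ univ) := by
  have hfst : MapsTo (Prod.fst : Jet2 n N → Jet n N) (J ×ˢ univ) J := fun k hk => hk.1
  have hsnd : ∀ b μ ν, ContDiff ℝ ∞ (fun k : Jet2 n N => k.2 b μ ν) := fun b μ ν =>
    contDiff_pi.1 (contDiff_pi.1 (contDiff_pi.1 contDiff_snd b) μ) ν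
  refine (ContDiffOn.neg (ContDiffOn.sum fun μ _ => ContDiffOn.sum fun ν _ =>
    ContDiffOn.sum fun b _ => ?_)).add ((contDiffOn_V hJ hℒ a).comp contDiff_fst.contDiffOn hfst)
  exact ((contDiffOn_W hJ hℒ μ ν a b).comp contDiff_fst.contDiffOn hfst).mul
    (hsnd b μ ν).contDiffOn

lemma euler_eq_eulerJet (hJ : IsOpen J) (hℒ : ContDiffOn ℝ ∞ ℒ J) (h : IsLocalField J O φ)
    (hx : x ∈ O) (a : Fin N) : euler ℒ φ a x = eulerJet ℒ a (jet2 φ x) :=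
  euler_eq hJ hℒ h hx a

namespace Descriptors

/-- The coefficient of `ε_α` in the current `λ^μ`. -/
noncomputable def currentCoeff₀ (D : Descriptors n N r) (ℒ : Jet n N → ℝ) (α : Fin r)
    (μ : Fin (n + 1)) (k : Jet2 n N) : ℝ :=
  ℒ k.1 * D.A α μ k.1 + ∑ a, dVel ℒ a μ k.1 * D.BA α a k.1 + ∑ a, eulerJet ℒ a k * D.C α a μ k.1

/-- The coefficient of `∂_ν ε_α` in the current `λ^μ`. -/
noncomputable def currentCoeff₁ (D : Descriptors n N r) (ℒ : Jet n N → ℝ) (α : Fin r)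
    (μ ν : Fin (n + 1)) (j : Jet n N) : ℝ :=
  ∑ a, dVel ℒ a μ j * D.C α a ν j

lemma contDiffOn_currentCoeff₀ (hJ : IsOpen J) (hℒ : ContDiffOn ℝ ∞ ℒ J) (hD : D.SmoothOn J)
    (α : Fin r) (μ : Fin (n + 1)) :
    ContDiffOn ℝ ∞ (D.currentCoeff₀ ℒ α μ) (J ×ˢ univ) := by
  have hlift : ∀ {F : Jet n N → ℝ}, ContDiffOn ℝ ∞ F J →
      ContDiffOn ℝ ∞ (fun k : Jet2 n N => F k.1) (J ×ˢ univ) := fun hF =>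
    hF.comp contDiff_fst.contDiffOn fun k hk => hk.1
  exact (((hlift hℒ).mul (hlift (hD.1 α μ))).add (ContDiffOn.sum fun a _ =>
    (hlift (contDiffOn_dVel hJ hℒ a μ)).mul (hlift (hD.contDiffOn_BA α a)))).add
    (ContDiffOn.sum fun a _ => (contDiffOn_eulerJet hJ hℒ a).mul (hlift (hD.2.2 α a μ)))

lemma contDiffOn_currentCoeff₁ (hJ : IsOpen J) (hℒ : ContDiffOn ℝ ∞ ℒ J) (hD : D.SmoothOn J)
    (α : Fin r) (μ ν : Fin (n + 1)) : ContDiffOn ℝ ∞ (D.currentCoeff₁ ℒ α μ ν) J :=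
  ContDiffOn.sum fun a _ => (contDiffOn_dVel hJ hℒ a μ).mul (hD.2.2 α a ν)

/-- The coefficients are chosen so that the Noether current is completed by exactly the divergence
term split off in `euler_mul_deltaBar`. Second derivatives enter only through the Euler derivative
multiplying ε. -/
lemma localCurrent_eq (hJ : IsOpen J) (hℒ : ContDiffOn ℝ ∞ ℒ J) (h : IsLocalField J O φ)
    (hx : x ∈ O) (μ : Fin (n + 1)) :
    localCurrent (D.currentCoeff₀ ℒ) (D.currentCoeff₁ ℒ) ε φ μ x
      = D.noetherCurrent ℒ ε φ μ x + ∑ α, ε x α * ∑ a, euler ℒ φ a x * D.C α a μ (jet φ x) := by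
  have e1 : ∑ a, dVel ℒ a μ (jet φ x) * ∑ α, ε x α * D.BA α a (jet φ x)
      = ∑ α, ε x α * ∑ a, dVel ℒ a μ (jet φ x) * D.BA α a (jet φ x) := by
    simp only [Finset.mul_sum]
    rw [Finset.sum_comm]
    exact Finset.sum_congr rfl fun α _ => Finset.sum_congr rfl fun a _ => by ring
  have e2 : ∑ a, dVel ℒ a μ (jet φ x) * ∑ α, ∑ ν, pd ν (fun y => ε y α) x * D.C α a ν (jet φ x)
      = ∑ α, ∑ ν, pd ν (fun y => ε y α) x * ∑ a, dVel ℒ a μ (jet φ x) * D.C α a ν (jet φ x) := by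
    simp only [Finset.mul_sum]
    rw [Finset.sum_comm]
    refine Finset.sum_congr rfl fun α _ => ?_
    rw [Finset.sum_comm]
    exact Finset.sum_congr rfl fun ν _ => Finset.sum_congr rfl fun a _ => by ring
  have e3 : ℒ (jet φ x) * ∑ α, ε x α * D.A α μ (jet φ x)
      = ∑ α, ε x α * (ℒ (jet φ x) * D.A α μ (jet φ x)) := by
    rw [Finset.mul_sum]
    exact Finset.sum_congr rfl fun α _ => by ring
  have h2 : (jet2 φ x).1 = jet φ x := rfl
  simp only [localCurrent, currentCoeff₀, currentCoeff₁, noetherCurrent, deltaBar_eq, h2,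
    ← euler_eq_eulerJet hJ hℒ h hx, mul_add, Finset.sum_add_distrib, e1, e2, deltaX, e3]
  ring

lemma contDiffOn_localCurrent (hJ : IsOpen J) (hℒ : ContDiffOn ℝ ∞ ℒ J) (hD : D.SmoothOn J)
    (h : IsLocalField J O φ) (hε : ContDiffOn ℝ ∞ ε O) (μ : Fin (n + 1)) :
    ContDiffOn ℝ ∞ (localCurrent (D.currentCoeff₀ ℒ) (D.currentCoeff₁ ℒ) ε φ μ) O :=
  ((contDiffOn_noetherCurrent hJ hℒ hD h hε μ).add (ContDiffOn.sum fun α _ =>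
    (contDiffOn_pi.1 hε α).mul (contDiffOn_euler_mul_C hJ hℒ hD h α μ))).congr
    fun _ hy => localCurrent_eq hJ hℒ h hy μ

/-- The variation differs from the divergence of this current by ε_α E^α, which vanishes pointwise.
Hence ε need not have compact support. -/
lemma variationIsDivergence_localCurrent (hJ : IsOpen J) (hℒ : ContDiffOn ℝ ∞ ℒ J)
    (hD : D.SmoothOn J) (hinv : ActionInvariant J ℒ D) (h : IsLocalField J O φ)
    (hε : ContDiffOn ℝ ∞ ε O) (hx : x ∈ O) :
    VariationIsDivergence ℒ D ε φ
      (localCurrent (D.currentCoeff₀ ℒ) (D.currentCoeff₁ ℒ) ε φ) x := by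
  have hp : ∀ μ, pd μ (localCurrent (D.currentCoeff₀ ℒ) (D.currentCoeff₁ ℒ) ε φ μ) x
      = pd μ (D.noetherCurrent ℒ ε φ μ) x
        + pd μ (fun y => ∑ α, ε y α * ∑ a, euler ℒ φ a y * D.C α a μ (jet φ y)) x := fun μ => by
    rw [pd_congr ((h.1.eventually_mem hx).mono fun y hy => localCurrent_eq hJ hℒ h hy μ), pd_add]
    · exact ContDiffOn.differentiableAt_of_isOpen
        (contDiffOn_noetherCurrent hJ hℒ hD h hε μ) h.1 hx
    · refine ContDiffOn.differentiableAt_of_isOpen (s := O) (ContDiffOn.sum fun α _ => ?_) h.1 hx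
      exact (contDiffOn_pi.1 hε α).mul (contDiffOn_euler_mul_C hJ hℒ hD h α μ)
  rw [VariationIsDivergence, deltaLagrangian_eq hJ hℒ hD h hε hx,
    euler_mul_deltaBar hJ hℒ hD h hε hx]
  simp only [eulerIdentity_eq_zero hJ hℒ hD hinv h hx, hp, Finset.sum_add_distrib, mul_zero,
    Finset.sum_const_zero, add_zero]

lemma bianchiIdentity_of_variationIsDivergence (hJ : IsOpen J) (hℒ : ContDiffOn ℝ ∞ ℒ J)
    (hD : D.SmoothOn J) (h : IsLocalField J O φ) (hε : ContDiffOn ℝ ∞ ε O)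
    {lam : Fin (n + 1) → Spacetime n → ℝ} (hlam : ∀ μ, ContDiffOn ℝ ∞ (lam μ) O) (hx : x ∈ O)
    (hdiv : VariationIsDivergence ℒ D ε φ lam x) : BianchiIdentity ℒ D ε φ lam x := by
  rw [VariationIsDivergence, deltaLagrangian_eq hJ hℒ hD h hε hx] at hdiv
  have hp : ∀ μ, pd μ (fun y => ℒ (jet φ y) * D.deltaX ε φ y μ
      + ∑ a, dVel ℒ a μ (jet φ y) * D.deltaBar ε φ y a - lam μ y) x
      = pd μ (D.noetherCurrent ℒ ε φ μ) x - pd μ (lam μ) x := fun μ =>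
    pd_sub (ContDiffOn.differentiableAt_of_isOpen
      (contDiffOn_noetherCurrent hJ hℒ hD h hε μ) h.1 hx)
      (ContDiffOn.differentiableAt_of_isOpen (hlam μ) h.1 hx) μ
  rw [BianchiIdentity, Finset.sum_congr rfl fun μ _ => hp μ, Finset.sum_sub_distrib, ← hdiv]
  ring

/-- The identities between the Euler derivatives in terms of third derivatives of the field. -/
lemma eulerIdentity_eq (hJ : IsOpen J) (hℒ : ContDiffOn ℝ ∞ ℒ J) (hD : D.SmoothOn J)
    (h : IsLocalField J O φ) (hx : x ∈ O) (α : Fin r) :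
    D.eulerIdentity ℒ φ α x =
      ∑ a, euler ℒ φ a x * (D.BA α a (jet φ x) - ∑ μ, pd μ (fun y => D.C α a μ (jet φ y)) x)
      - ∑ a, ∑ μ, D.C α a μ (jet φ x) * pd μ (fun y => V ℒ a (jet φ y)) x
      + ∑ a, ∑ μ, D.C α a μ (jet φ x) * ∑ ρ, ∑ σ, ∑ b,
          (pd μ (fun y => W ℒ ρ σ a b (jet φ y)) x * pd ρ (pd σ (fun y => φ y b)) x
            + W ℒ ρ σ a b (jet φ x) * pd μ (pd ρ (pd σ (fun y => φ y b))) x) := by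
  have dL : ∀ a, DifferentiableAt ℝ (euler ℒ φ a) x := fun a =>
    ContDiffOn.differentiableAt_of_isOpen (h.contDiffOn_euler hJ hℒ a) h.1 hx
  have dC : ∀ a μ, DifferentiableAt ℝ (fun y => D.C α a μ (jet φ y)) x := fun a μ =>
    ContDiffOn.differentiableAt_of_isOpen (h.contDiffOn_along (hD.2.2 α a μ)) h.1 hx
  have hp : ∀ μ, pd μ (fun y => ∑ a, euler ℒ φ a y * D.C α a μ (jet φ y)) x
      = ∑ a, (pd μ (euler ℒ φ a) x * D.C α a μ (jet φ x)
        + euler ℒ φ a x * pd μ (fun y => D.C α a μ (jet φ y)) x) := fun μ => by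
    rw [pd_sum fun a _ => (dL a).fun_mul (dC a μ)]
    exact Finset.sum_congr rfl fun a _ => pd_mul (dL a) (dC a μ) μ
  rw [eulerIdentity, Finset.sum_congr rfl fun μ _ => hp μ, Finset.sum_comm,
    ← Finset.sum_sub_distrib, ← Finset.sum_sub_distrib, ← Finset.sum_add_distrib]
  refine Finset.sum_congr rfl fun a _ => ?_
  rw [mul_sub, Finset.mul_sum, sub_sub, sub_add, ← Finset.sum_add_distrib,
    ← Finset.sum_sub_distrib]
  congr 1
  refine Finset.sum_congr rfl fun μ _ => ?_
  rw [pd_euler hJ hℒ h hx]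
  ring

end Descriptors

/-! ### Fields with prescribed jets -/

/-- By the chain rule only the second-order jet is seen. This cancels everything except third
derivatives when two fields are compared. -/
lemma pd_along_jet_congr (hJ : IsOpen J) {O' : Set (Spacetime n)} {ψ : Spacetime n → Target N}
    (h : IsLocalField J O φ) (h' : IsLocalField J O' ψ) {F : Jet n N → ℝ}
    (hF : ContDiffOn ℝ ∞ F J) (hx : x ∈ O) (hx' : x ∈ O') (h2 : jet2 φ x = jet2 ψ x)
    (μ : Fin (n + 1)) : pd μ (fun y => F (jet φ y)) x = pd μ (fun y => F (jet ψ y)) x := by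
  have hj : jet φ x = jet ψ x := congrArg Prod.fst h2
  have hv : ∀ b, pd μ (fun y => φ y b) x = pd μ (fun y => ψ y b) x := fun b =>
    congrFun (congrFun (congrArg (fun j => j.2.2) hj) b) μ
  have hw : ∀ b ν, pd μ (pd ν (fun y => φ y b)) x = pd μ (pd ν (fun y => ψ y b)) x := fun b ν =>
    congrFun (congrFun (congrFun (congrArg Prod.snd h2) b) μ) ν
  rw [pd_along_jet hJ h hF hx, pd_along_jet hJ h' hF hx']
  simp only [hj, hv, hw]

lemma pd_sub_const_apply (x₀ : Spacetime n) (τ μ : Fin (n + 1)) :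
    pd τ (fun y => y μ - x₀ μ) x = if μ = τ then 1 else 0 := by
  have h : HasFDerivAt (fun y : Spacetime n => y μ - x₀ μ)
      (ContinuousLinearMap.proj (R := ℝ) (φ := fun _ : Fin (n + 1) => ℝ) μ) x :=
    (hasFDerivAt_apply μ x).sub_const (x₀ μ)
  rw [pd, h.fderiv]
  simp [Pi.single_apply]

/-- Every jet in `J` extends to a field whose second derivatives are prescribed by a function `q`
vanishing to first order. -/
lemma exists_field (hJ : IsOpen J) {j : Jet n N} (hj : j ∈ J) (b : Fin N) {q : Spacetime n → ℝ}
    (hq : ContDiff ℝ ∞ q) (hq0 : q j.1 = 0) (hq1 : ∀ μ, pd μ q j.1 = 0) :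
    ∃ O φ, IsLocalField J O φ ∧ j.1 ∈ O ∧ jet φ j.1 = j ∧
      ∀ a ρ σ, pd ρ (pd σ (fun y => φ y a)) = fun y => if a = b then pd ρ (pd σ q) y else 0 := by
  -- The affine field with jet j, perturbed by q in the component b; restricting to the preimage of
  -- J makes it an admissible field.
  let φ : Spacetime n → Target N := fun y a =>
    (j.2.1 a + ∑ μ, j.2.2 a μ * (y μ - j.1 μ)) + if a = b then q y else 0
  have dc : ∀ (μ : Fin (n + 1)) (y : Spacetime n),
      DifferentiableAt ℝ (fun y : Spacetime n => y μ - j.1 μ) y := fun μ y => by fun_prop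
  have dl : ∀ (a : Fin N) (y : Spacetime n), DifferentiableAt ℝ
      (fun y : Spacetime n => j.2.1 a + ∑ μ, j.2.2 a μ * (y μ - j.1 μ)) y := fun a y => by fun_prop
  have dq : ∀ y, DifferentiableAt ℝ q y := fun y => hq.differentiable (by simp) y
  have sφ : ContDiff ℝ ∞ φ := contDiff_pi.2 fun a => by
    have h1 : ContDiff ℝ ∞
        (fun y : Spacetime n => j.2.1 a + ∑ μ, j.2.2 a μ * (y μ - j.1 μ)) := by fun_prop
    by_cases hab : a = b
    · simpa [φ, hab] using h1.add hq
    · simpa [φ, hab] using h1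
  have hp : ∀ a σ, pd σ (fun y => φ y a)
      = fun y => j.2.2 a σ + if a = b then pd σ q y else 0 := fun a σ => by
    ext y
    have h1 : pd σ (fun y : Spacetime n => j.2.1 a + ∑ μ, j.2.2 a μ * (y μ - j.1 μ)) y
        = j.2.2 a σ := by
      rw [pd_add (by fun_prop) (by fun_prop), pd_const, zero_add,
        pd_sum fun μ _ => (differentiableAt_const _).fun_mul (dc μ y)]
      simp only [pd_mul (differentiableAt_const _) (dc _ y), pd_const, pd_sub_const_apply]
      simp
    by_cases hab : a = b
    · simp only [φ, hab, if_true] at h1 ⊢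
      rw [pd_add (dl b y) (dq y), h1]
    · simpa [φ, hab] using h1
  have hjet : jet φ j.1 = j := by
    refine Prod.ext rfl (Prod.ext ?_ ?_)
    · ext a
      simp [jet, φ, hq0]
    · ext a σ
      simp [jet, hp, hq1]
  have sjet : ContDiffOn ℝ ∞ (jet φ) univ := contDiffOn_jet isOpen_univ sφ.contDiffOn
  refine ⟨jet φ ⁻¹' J, φ, ⟨?_, sφ.contDiffOn, fun y hy => hy⟩, by simpa [hjet] using hj, hjet, ?_⟩
  · exact hJ.preimage (continuousOn_univ.1 sjet.continuousOn)
  · intro a ρ σ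
    rw [hp]
    ext y
    by_cases hab : a = b
    · simp only [hab, if_true]
      have hd : DifferentiableAt ℝ (pd σ q) y := ContDiffOn.differentiableAt_of_isOpen
        (contDiffOn_pd isOpen_univ hq.contDiffOn σ) isOpen_univ (mem_univ y)
      rw [pd_add (differentiableAt_const _) hd, pd_const, zero_add]
    · simp only [hab, if_false, add_zero, pd_const]

/-! ### Derivatives of quadratic and cubic monomials. -/

section Monomials

variable (x₀ : Spacetime n) (μ ν κ : Fin (n + 1))

lemma pd_monomial₂ (τ : Fin (n + 1)) : pd τ (fun y => (y μ - x₀ μ) * (y ν - x₀ ν))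
    = fun y => (if μ = τ then 1 else 0) * (y ν - x₀ ν) + (y μ - x₀ μ) * if ν = τ then 1 else 0 := by
  ext y
  rw [pd_mul (by fun_prop) (by fun_prop), pd_sub_const_apply, pd_sub_const_apply]

lemma pd_pd_monomial₂ (τ υ : Fin (n + 1)) :
    pd υ (pd τ (fun y => (y μ - x₀ μ) * (y ν - x₀ ν)))
    = fun _ => (if μ = τ then 1 else 0) * (if ν = υ then 1 else 0)
      + (if μ = υ then 1 else 0) * if ν = τ then 1 else 0 := by
  ext y
  rw [pd_monomial₂, pd_add (by fun_prop) (by fun_prop), pd_mul (by fun_prop) (by fun_prop),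
    pd_mul (by fun_prop) (by fun_prop), pd_sub_const_apply, pd_sub_const_apply, pd_const, pd_const]
  ring

lemma pd_monomial₃ (τ : Fin (n + 1)) :
    pd τ (fun y => (y μ - x₀ μ) * ((y ν - x₀ ν) * (y κ - x₀ κ)))
    = fun y => (if μ = τ then 1 else 0) * ((y ν - x₀ ν) * (y κ - x₀ κ))
      + ((if ν = τ then 1 else 0) * ((y μ - x₀ μ) * (y κ - x₀ κ))
      + (if κ = τ then 1 else 0) * ((y μ - x₀ μ) * (y ν - x₀ ν))) := by
  ext y
  rw [pd_mul (by fun_prop) (by fun_prop), pd_sub_const_apply, pd_monomial₂]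
  ring

lemma pd_const_mul {f : Spacetime n → ℝ} (c : ℝ) (hf : DifferentiableAt ℝ f x) (τ : Fin (n + 1)) :
    pd τ (fun y => c * f y) x = c * pd τ f x := by
  rw [pd_mul (differentiableAt_const c) hf, pd_const, zero_mul, zero_add]

lemma pd_pd_monomial₃ (τ υ : Fin (n + 1)) :
    pd υ (pd τ (fun y => (y μ - x₀ μ) * ((y ν - x₀ ν) * (y κ - x₀ κ))))
    = fun y => (if μ = τ then 1 else 0) * pd υ (fun y => (y ν - x₀ ν) * (y κ - x₀ κ)) y
      + ((if ν = τ then 1 else 0) * pd υ (fun y => (y μ - x₀ μ) * (y κ - x₀ κ)) y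
      + (if κ = τ then 1 else 0) * pd υ (fun y => (y μ - x₀ μ) * (y ν - x₀ ν)) y) := by
  ext y
  rw [pd_monomial₃, pd_add (by fun_prop) (by fun_prop), pd_add (by fun_prop) (by fun_prop),
    pd_const_mul _ (by fun_prop), pd_const_mul _ (by fun_prop), pd_const_mul _ (by fun_prop)]

lemma pd_pd_pd_monomial₃ (τ υ σ : Fin (n + 1)) :
    pd σ (pd υ (pd τ (fun y => (y μ - x₀ μ) * ((y ν - x₀ ν) * (y κ - x₀ κ)))))
    = fun y => (if μ = τ then 1 else 0) * pd σ (pd υ (fun y => (y ν - x₀ ν) * (y κ - x₀ κ))) y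
      + ((if ν = τ then 1 else 0) * pd σ (pd υ (fun y => (y μ - x₀ μ) * (y κ - x₀ κ))) y
      + (if κ = τ then 1 else 0) * pd σ (pd υ (fun y => (y μ - x₀ μ) * (y ν - x₀ ν))) y) := by
  have hd : ∀ (α β : Fin (n + 1)) (y : Spacetime n), DifferentiableAt ℝ
      (pd υ (fun y => (y α - x₀ α) * (y β - x₀ β))) y := fun α β y => by
    rw [pd_monomial₂]
    fun_prop
  ext y
  rw [pd_pd_monomial₃, pd_add ((hd _ _ _).const_mul _)
      (((hd _ _ _).const_mul _).fun_add ((hd _ _ _).const_mul _)),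
    pd_add ((hd _ _ _).const_mul _) ((hd _ _ _).const_mul _),
    pd_const_mul _ (hd _ _ _), pd_const_mul _ (hd _ _ _), pd_const_mul _ (hd _ _ _)]

end Monomials

lemma pd_pd_zero (τ υ : Fin (n + 1)) :
    pd υ (pd τ (fun _ : Spacetime n => (0 : ℝ))) = fun _ => 0 := by
  have h : ∀ τ, pd τ (fun _ : Spacetime n => (0 : ℝ)) = fun _ => 0 := fun τ =>
    funext fun y => pd_const 0 τ
  rw [h, h]

/-! ### Null vectors of the Hessian -/

lemma euler_congr (hJ : IsOpen J) (hℒ : ContDiffOn ℝ ∞ ℒ J) {O' : Set (Spacetime n)}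
    {ψ : Spacetime n → Target N} (h : IsLocalField J O φ) (h' : IsLocalField J O' ψ)
    (hx : x ∈ O) (hx' : x ∈ O') (h2 : jet2 φ x = jet2 ψ x) (a : Fin N) :
    euler ℒ φ a x = euler ℒ ψ a x := by
  rw [euler_eq_eulerJet hJ hℒ h hx, euler_eq_eulerJet hJ hℒ h' hx', h2]

namespace Descriptors

/-- For two fields with the same second-order jet, the third derivatives enter the identities
between the Euler derivatives only through `C^{αaμ} W^{ρσ}_{ab}`. -/
lemma sum_C_mul_W_mul_third_congr (hJ : IsOpen J) (hℒ : ContDiffOn ℝ ∞ ℒ J) (hD : D.SmoothOn J)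
    (hinv : ActionInvariant J ℒ D) {O' : Set (Spacetime n)} {ψ : Spacetime n → Target N}
    (h : IsLocalField J O φ) (h' : IsLocalField J O' ψ)
    (hx : x ∈ O) (hx' : x ∈ O') (h2 : jet2 φ x = jet2 ψ x) (α : Fin r) :
    ∑ a, ∑ μ, D.C α a μ (jet φ x) * ∑ ρ, ∑ σ, ∑ b,
        W ℒ ρ σ a b (jet φ x) * pd μ (pd ρ (pd σ (fun y => φ y b))) x
      = ∑ a, ∑ μ, D.C α a μ (jet φ x) * ∑ ρ, ∑ σ, ∑ b,
        W ℒ ρ σ a b (jet φ x) * pd μ (pd ρ (pd σ (fun y => ψ y b))) x := by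
  have hj : jet φ x = jet ψ x := congrArg Prod.fst h2
  have hw : ∀ b ρ σ, pd ρ (pd σ (fun y => φ y b)) x = pd ρ (pd σ (fun y => ψ y b)) x :=
    fun b ρ σ => congrFun (congrFun (congrFun (congrArg Prod.snd h2) b) ρ) σ
  have e1 := eulerIdentity_eq hJ hℒ hD h hx α
  have e2 := eulerIdentity_eq hJ hℒ hD h' hx' α
  rw [eulerIdentity_eq_zero hJ hℒ hD hinv h hx] at e1
  rw [eulerIdentity_eq_zero hJ hℒ hD hinv h' hx'] at e2
  -- All terms determined by the second-order jet become literally equal, so subtracting the two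
  -- identities leaves the third derivatives.
  simp only [euler_congr hJ hℒ h h' hx hx' h2, hw,
    fun a μ => pd_along_jet_congr hJ h h' (hD.2.2 α a μ) hx hx' h2 μ,
    fun a μ => pd_along_jet_congr hJ h h' (contDiffOn_V hJ hℒ a) hx hx' h2 μ,
    fun ρ σ a b μ => pd_along_jet_congr hJ h h' (contDiffOn_W hJ hℒ ρ σ a b) hx hx' h2 μ, hj,
    Finset.sum_add_distrib, mul_add] at e1 e2 ⊢
  linarith

/-- The monomial (y-x)^μ (y-x)^ρ (y-x)^σ has zero second-order jet at x, and its third derivatives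
there are the sum of Kronecker deltas over the six permutations. Comparing the field it perturbs
with the affine one produces the symmetrization. -/
theorem sym3_C_mul_W (hJ : IsOpen J) (hℒ : ContDiffOn ℝ ∞ ℒ J) (hD : D.SmoothOn J)
    (hinv : ActionInvariant J ℒ D) {j : Jet n N} (hj : j ∈ J) (α : Fin r) (b : Fin N)
    (μ ρ σ : Fin (n + 1)) :
    sym3 (fun μ' ρ' σ' => ∑ a, D.C α a μ' j * W ℒ ρ' σ' a b j) μ ρ σ = 0 := by
  obtain ⟨O, φ, h, hx, hjφ, hφ⟩ := exists_field hJ hj b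
    (q := fun y => (y μ - j.1 μ) * ((y ρ - j.1 ρ) * (y σ - j.1 σ))) (by fun_prop) (by simp)
    (fun τ => by simp [pd_monomial₃])
  obtain ⟨O', ψ, h', hx', hjψ, hψ⟩ := exists_field hJ hj b (q := fun _ => 0) contDiff_const rfl
    (fun τ => pd_const 0 τ)
  have h2 : jet2 φ j.1 = jet2 ψ j.1 := by
    refine Prod.ext (hjφ.trans hjψ.symm) ?_
    ext a τ υ
    simp [jet2, hφ, hψ, pd_pd_zero, pd_pd_monomial₃, pd_monomial₂]
  have key := sum_C_mul_W_mul_third_congr hJ hℒ hD hinv h h' hx hx' h2 α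
  have e1 : ∀ a υ τ κ, pd κ (pd υ (pd τ (fun y => φ y a))) j.1 = if a = b then
      pd κ (pd υ (pd τ (fun y => (y μ - j.1 μ) * ((y ρ - j.1 ρ) * (y σ - j.1 σ))))) j.1 else 0 :=
    fun a υ τ κ => by
      rw [hφ]
      split_ifs
      · rfl
      · exact pd_const 0 κ
  have e2 : ∀ a υ τ κ, pd κ (pd υ (pd τ (fun y => ψ y a))) j.1 = 0 := fun a υ τ κ => by
    rw [hψ, pd_pd_zero]
    simp [pd_const]
  simp only [hjφ, e1, e2, mul_zero, mul_ite, Finset.sum_const_zero, Finset.sum_ite_eq',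
    Finset.mem_univ, if_true, pd_pd_pd_monomial₃, pd_pd_monomial₂] at key
  simp only [mul_add, Finset.sum_add_distrib, mul_ite, mul_one, mul_zero, Finset.sum_ite_eq,
    Finset.mem_univ, if_true, Finset.sum_const_zero,
    Finset.sum_ite_irrel] at key
  simp only [sym3]
  linarith

theorem vecMul_C_hessian (hJ : IsOpen J) (hℒ : ContDiffOn ℝ ∞ ℒ J) (hD : D.SmoothOn J)
    (hinv : ActionInvariant J ℒ D) {j : Jet n N} (hj : j ∈ J) (α : Fin r) :
    Matrix.vecMul (fun a => D.C α a 0 j) (hessian ℒ j) = 0 := by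
  ext b
  have := sym3_C_mul_W hJ hℒ hD hinv hj α b 0 0 0
  simp only [sym3] at this
  simp only [Matrix.vecMul, dotProduct, hessian, Matrix.of_apply, Pi.zero_apply]
  linarith

/-- If `C^{αa0}` vanishes at a jet, every `C^{αaμ}` is a null vector of the Hessian there. -/
lemma vecMul_C_hessian_of_C_zero (hJ : IsOpen J) (hℒ : ContDiffOn ℝ ∞ ℒ J) (hD : D.SmoothOn J)
    (hinv : ActionInvariant J ℒ D) {j : Jet n N} (hj : j ∈ J) (α : Fin r)
    (h0 : ∀ a, D.C α a 0 j = 0) (μ : Fin (n + 1)) :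
    Matrix.vecMul (fun a => D.C α a μ j) (hessian ℒ j) = 0 := by
  ext b
  -- Of the six permutations of (μ, 0, 0), four carry the factor C^{αa0} and drop out; the other two
  -- are C^{αaμ} W^{00}.
  have := sym3_C_mul_W hJ hℒ hD hinv hj α b μ 0 0
  simp only [sym3, h0, zero_mul, Finset.sum_const_zero] at this
  simp only [Matrix.vecMul, dotProduct, hessian, Matrix.of_apply, Pi.zero_apply]
  linarith

/-- Since C vanishes on all of J, L_a C^{αaμ} is zero along the field near x, and so is its
divergence. A single jet with C = 0 would not suffice. -/
lemma sum_BA_mul_euler_eq_zero (hJ : IsOpen J) (hℒ : ContDiffOn ℝ ∞ ℒ J) (hD : D.SmoothOn J)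
    (hinv : ActionInvariant J ℒ D) {α : Fin r} (hC : ∀ j ∈ J, ∀ a μ, D.C α a μ j = 0)
    (h : IsLocalField J O φ) (hx : x ∈ O) :
    ∑ a, D.BA α a (jet φ x) * euler ℒ φ a x = 0 := by
  have e := eulerIdentity_eq_zero hJ hℒ hD hinv h hx α
  have hz : ∀ μ, pd μ (fun y => ∑ a, euler ℒ φ a y * D.C α a μ (jet φ y)) x = 0 := fun μ => by
    rw [pd_congr (g := fun _ => 0) ((h.1.eventually_mem hx).mono fun y hy => by
      simp [hC _ (h.2.2 y hy)]), pd_const]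
  simp only [eulerIdentity, hz, Finset.sum_const_zero, sub_zero] at e
  simpa only [mul_comm] using e

/-- The contraction of B - ∂φ A with L is affine in the second derivatives. On the affine field only
the V term survives, so it vanishes; perturbing by a quadratic monomial then leaves the symmetrized
coefficient of W. -/
theorem sum_BA_mul_sym2_W (hJ : IsOpen J) (hℒ : ContDiffOn ℝ ∞ ℒ J) (hD : D.SmoothOn J)
    (hinv : ActionInvariant J ℒ D) {α : Fin r} (hC : ∀ j ∈ J, ∀ a μ, D.C α a μ j = 0)
    {j : Jet n N} (hj : j ∈ J) (b : Fin N) (μ ν : Fin (n + 1)) :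
    ∑ a, D.BA α a j * sym2 (fun μ' ν' => W ℒ μ' ν' a b j) μ ν = 0 := by
  obtain ⟨O, φ, h, hx, hjφ, hφ⟩ := exists_field hJ hj b
    (q := fun y => (y μ - j.1 μ) * (y ν - j.1 ν)) (by fun_prop) (by simp)
    (fun τ => by simp [pd_monomial₂])
  obtain ⟨O', ψ, h', hx', hjψ, hψ⟩ := exists_field hJ hj b (q := fun _ => 0) contDiff_const rfl
    (fun τ => pd_const 0 τ)
  have e1 := sum_BA_mul_euler_eq_zero hJ hℒ hD hinv hC h hx
  have e2 := sum_BA_mul_euler_eq_zero hJ hℒ hD hinv hC h' hx'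
  simp only [euler_eq hJ hℒ h hx, hjφ, hφ, pd_pd_monomial₂] at e1
  simp only [euler_eq hJ hℒ h' hx', hjψ, hψ, pd_pd_zero, ite_self, mul_zero, Finset.sum_const_zero,
    neg_zero, zero_add] at e2
  simp only [mul_add, Finset.sum_add_distrib, e2, add_zero, mul_ite, mul_one, mul_zero,
    Finset.sum_ite_eq, Finset.sum_ite_eq', Finset.mem_univ, if_true,
    Finset.sum_const_zero, Finset.sum_ite_irrel, mul_neg, Finset.sum_neg_distrib] at e1
  simp only [sym2, mul_div_assoc', mul_add, ← Finset.sum_div, Finset.sum_add_distrib]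
  linarith

theorem vecMul_BA_hessian (hJ : IsOpen J) (hℒ : ContDiffOn ℝ ∞ ℒ J) (hD : D.SmoothOn J)
    (hinv : ActionInvariant J ℒ D) {α : Fin r} (hC : ∀ j ∈ J, ∀ a μ, D.C α a μ j = 0)
    {j : Jet n N} (hj : j ∈ J) : Matrix.vecMul (fun a => D.BA α a j) (hessian ℒ j) = 0 := by
  ext b
  have := sum_BA_mul_sym2_W hJ hℒ hD hinv hC hj b 0 0
  simp only [sym2, add_self_div_two] at this
  exact this

end Descriptors

/-! ### Localization in jet space and singularity of the Hessian. -/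

lemma det_eq_zero_of_vecMul_eq_zero {m : ℕ} {M : Matrix (Fin m) (Fin m) ℝ} {v : Fin m → ℝ}
    (h : Matrix.vecMul v M = 0) (hv : v ≠ 0) : M.det = 0 :=
  Matrix.exists_vecMul_eq_zero_iff.1 ⟨v, hv, h⟩

lemma continuousOn_det_hessian (hJ : IsOpen J) (hℒ : ContDiffOn ℝ ∞ ℒ J) :
    ContinuousOn (fun j => (hessian ℒ j).det) J :=
  ((contDiff_det N).comp_contDiffOn (contDiffOn_pi.2 fun a => contDiffOn_pi.2 fun b =>
    contDiffOn_W hJ hℒ 0 0 a b)).continuousOn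

/-- Fields with jets in the smaller set are fields for the larger one; this lets all earlier results
be applied on a small open set of jets. -/
lemma ActionInvariant.mono {J' : Set (Jet n N)} (hinv : ActionInvariant J ℒ D) (hJ' : J' ⊆ J) :
    ActionInvariant J' ℒ D := fun O φ h =>
  hinv O φ ⟨h.1, h.2.1, fun x hx => hJ' (h.2.2 x hx)⟩

lemma Descriptors.SmoothOn.mono {J' : Set (Jet n N)} (hD : D.SmoothOn J) (hJ' : J' ⊆ J) :
    D.SmoothOn J' :=
  ⟨fun α μ => (hD.1 α μ).mono hJ', fun α a => (hD.2.1 α a).mono hJ',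
    fun α a μ => (hD.2.2 α a μ).mono hJ'⟩

/-- Gauge theories are singular where the local transformations act on the fields. -/
theorem det_hessian_eq_zero_of_actsAt (hJ : IsOpen J) (hℒ : ContDiffOn ℝ ∞ ℒ J)
    (hD : D.SmoothOn J) (hinv : ActionInvariant J ℒ D) {j : Jet n N} (hj : j ∈ J)
    (hact : D.ActsAt j) : (hessian ℒ j).det = 0 := by
  by_contra hdet
  -- Working on an open set is essential: the null vector B - ∂φ A is available only where C
  -- vanishes identically, not at one jet.
  set J' : Set (Jet n N) := J ∩ (fun j => (hessian ℒ j).det) ⁻¹' {0}ᶜ with hJ'def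
  have hJ' : IsOpen J' :=
    (continuousOn_det_hessian hJ hℒ).isOpen_inter_preimage hJ isOpen_compl_singleton
  have hsub : J' ⊆ J := inter_subset_left
  have hjJ' : j ∈ J' := ⟨hj, hdet⟩
  have hℒ' := hℒ.mono hsub
  have hD' := hD.mono hsub
  have hinv' := hinv.mono hsub
  have hC : ∀ α, ∀ i ∈ J', ∀ a μ, D.C α a μ i = 0 := fun α i hi a μ => by
    -- The time component C^{αa0} must vanish first; only then is each C^{αaμ} itself a null vector.
    have h0 := Matrix.eq_zero_of_vecMul_eq_zero hi.2
      (Descriptors.vecMul_C_hessian hJ' hℒ' hD' hinv' hi α)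
    exact congrFun (Matrix.eq_zero_of_vecMul_eq_zero hi.2
      (Descriptors.vecMul_C_hessian_of_C_zero hJ' hℒ' hD' hinv' hi α (congrFun h0) μ)) a
  obtain ⟨α, a, hBA | ⟨μ, hμ⟩⟩ := hact
  · exact hBA (congrFun (Matrix.eq_zero_of_vecMul_eq_zero hdet
      (Descriptors.vecMul_BA_hessian hJ' hℒ' hD' hinv' (hC α) hjJ')) a)
  · exact hμ (hC α j hjJ' a μ)

lemma det_ne_zero_iff_rank_eq {m : ℕ} (M : Matrix (Fin m) (Fin m) ℝ) :
    M.det ≠ 0 ↔ M.rank = m := by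
  rw [← isUnit_iff_ne_zero, ← Matrix.isUnit_iff_isUnit_det]
  refine ⟨fun h => by simpa using Matrix.rank_of_isUnit M h, fun h => ?_⟩
  rw [← Matrix.mulVec_surjective_iff_isUnit]
  have ht : LinearMap.range M.mulVecLin = ⊤ :=
    Submodule.eq_top_of_finrank_eq (by simpa [Matrix.rank] using h)
  exact LinearMap.range_eq_top.1 ht

end GaugeBianchi

theorem mainTheorem9 {n N r : ℕ}
    (J : Set (Jet n N)) (hJ : IsOpen J)
    (ℒ : Jet n N → ℝ) (hℒ : ContDiffOn ℝ ∞ ℒ J)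
    (D : Descriptors n N r) (hD : D.SmoothOn J)
    (hinv : ActionInvariant J ℒ D) :
    -- off-shell Bianchi identities, with a current that is local in the parameters and the fields
    (∃ (l₀ : Fin r → Fin (n + 1) → Jet2 n N → ℝ)
        (l₁ : Fin r → Fin (n + 1) → Fin (n + 1) → Jet n N → ℝ),
      (∀ α μ, ContDiffOn ℝ ∞ (l₀ α μ) (J ×ˢ Set.univ)) ∧
      (∀ α μ ν, ContDiffOn ℝ ∞ (l₁ α μ ν) J) ∧
      ∀ (O : Set (Spacetime n)) (φ : Spacetime n → Target N), IsLocalField J O φ →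
      ∀ ε : Spacetime n → Fin r → ℝ, ContDiffOn ℝ ∞ ε O → ∀ x ∈ O,
        VariationIsDivergence ℒ D ε φ (localCurrent l₀ l₁ ε φ) x ∧
        BianchiIdentity ℒ D ε φ (localCurrent l₀ l₁ ε φ) x) ∧
    -- the same identity for every current `lam` with `δ𝓛 + 𝓛 ∂_μ δx^μ = ∂_μ lam^μ`
    (∀ (O : Set (Spacetime n)) (φ : Spacetime n → Target N), IsLocalField J O φ →
      ∀ ε : Spacetime n → Fin r → ℝ, ContDiffOn ℝ ∞ ε O →
      ∀ lam : Fin (n + 1) → Spacetime n → ℝ, (∀ μ, ContDiffOn ℝ ∞ (lam μ) O) →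
        (∀ x ∈ O, VariationIsDivergence ℒ D ε φ lam x) →
        ∀ x ∈ O, BianchiIdentity ℒ D ε φ lam x) ∧
    -- off-shell identities for the Euler derivatives
    (∀ (O : Set (Spacetime n)) (φ : Spacetime n → Target N), IsLocalField J O φ →
      ∀ x ∈ O, ∀ α : Fin r,
        (∑ a, euler ℒ φ a x * D.BA α a (jet φ x)
          - ∑ μ, pd μ (fun y => ∑ a, euler ℒ φ a y * D.C α a μ (jet φ y)) x = 0) ∧
        (∀ a, euler ℒ φ a x
          = -(∑ μ, ∑ ν, ∑ b, W ℒ μ ν a b (jet φ x) * pd μ (pd ν (fun y => φ y b)) x)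
            + V ℒ a (jet φ x)) ∧
        (∑ a, euler ℒ φ a x *
            (D.BA α a (jet φ x) - ∑ μ, pd μ (fun y => D.C α a μ (jet φ y)) x)
          - ∑ a, ∑ μ, D.C α a μ (jet φ x) * pd μ (fun y => V ℒ a (jet φ y)) x
          + ∑ a, ∑ μ, D.C α a μ (jet φ x) * ∑ ρ, ∑ σ, ∑ b,
              (pd μ (fun y => W ℒ ρ σ a b (jet φ y)) x * pd ρ (pd σ (fun y => φ y b)) x
                + W ℒ ρ σ a b (jet φ x) * pd μ (pd ρ (pd σ (fun y => φ y b))) x) = 0)) ∧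
    -- `C^{αa(μ} W^{ρσ)}_{ab} = 0`
    (∀ j ∈ J, ∀ (α : Fin r) (b : Fin N) (μ ρ σ : Fin (n + 1)),
      sym3 (fun μ' ρ' σ' => ∑ a, D.C α a μ' j * W ℒ ρ' σ' a b j) μ ρ σ = 0) ∧
    -- `C^{αa0}`, where nonzero, is a null vector of the Hessian, which is then singular
    (∀ j ∈ J, ∀ α : Fin r,
      Matrix.vecMul (fun a => D.C α a 0 j) (hessian ℒ j) = 0 ∧
      ((fun a => D.C α a 0 j) ≠ 0 → (hessian ℒ j).det = 0)) ∧
    -- the case `C^{αaμ} ≡ 0`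
    (∀ α : Fin r, (∀ j ∈ J, ∀ a μ, D.C α a μ j = 0) →
      (∀ (O : Set (Spacetime n)) (φ : Spacetime n → Target N), IsLocalField J O φ →
        ∀ x ∈ O, ∑ a, D.BA α a (jet φ x) * euler ℒ φ a x = 0) ∧
      (∀ j ∈ J, ∀ (b : Fin N) (μ ν : Fin (n + 1)),
        ∑ a, D.BA α a j * sym2 (fun μ' ν' => W ℒ μ' ν' a b j) μ ν = 0) ∧
      (∀ j ∈ J, Matrix.vecMul (fun a => D.BA α a j) (hessian ℒ j) = 0 ∧
        ((fun a => D.BA α a j) ≠ 0 → (hessian ℒ j).det = 0))) ∧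
    -- gauge theories are necessarily singular
    (∀ j ∈ J, D.ActsAt j → (hessian ℒ j).det = 0) ∧
    ((∃ j ∈ J, D.ActsAt j) → ¬ IsRegularSystem J ℒ) ∧
    ((∃ j ∈ J, D.ActsAt j) →
      (∃ R : ℕ, ∀ j ∈ J, (hessian ℒ j).rank = R) → ∀ j ∈ J, (hessian ℒ j).det = 0) := by
  refine ⟨⟨D.currentCoeff₀ ℒ, D.currentCoeff₁ ℒ,
    Descriptors.contDiffOn_currentCoeff₀ hJ hℒ hD, Descriptors.contDiffOn_currentCoeff₁ hJ hℒ hD,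
    fun O φ h ε hε x hx => ?_⟩, fun O φ h ε hε lam hlam hdiv x hx => ?_,
    fun O φ h x hx α => ⟨?_, fun a => ?_, ?_⟩, fun j hj α b μ ρ σ => ?_, fun j hj α => ?_,
    fun α hC => ⟨fun O φ h x hx => ?_, fun j hj b μ ν => ?_, fun j hj => ?_⟩,
    fun j hj hact => ?_, ?_, ?_⟩
  · have hdiv := Descriptors.variationIsDivergence_localCurrent hJ hℒ hD hinv h hε hx
    exact ⟨hdiv, Descriptors.bianchiIdentity_of_variationIsDivergence hJ hℒ hD h hε
      (Descriptors.contDiffOn_localCurrent hJ hℒ hD h hε) hx hdiv⟩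
  · exact Descriptors.bianchiIdentity_of_variationIsDivergence hJ hℒ hD h hε hlam hx (hdiv x hx)
  · exact Descriptors.eulerIdentity_eq_zero hJ hℒ hD hinv h hx α
  · exact euler_eq hJ hℒ h hx a
  · rw [← Descriptors.eulerIdentity_eq hJ hℒ hD h hx]
    exact Descriptors.eulerIdentity_eq_zero hJ hℒ hD hinv h hx α
  · exact Descriptors.sym3_C_mul_W hJ hℒ hD hinv hj α b μ ρ σ
  · have hnull := Descriptors.vecMul_C_hessian hJ hℒ hD hinv hj α
    exact ⟨hnull, det_eq_zero_of_vecMul_eq_zero hnull⟩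
  · exact Descriptors.sum_BA_mul_euler_eq_zero hJ hℒ hD hinv hC h hx
  · exact Descriptors.sum_BA_mul_sym2_W hJ hℒ hD hinv hC hj b μ ν
  · have hnull := Descriptors.vecMul_BA_hessian hJ hℒ hD hinv hC hj
    exact ⟨hnull, det_eq_zero_of_vecMul_eq_zero hnull⟩
  · exact det_hessian_eq_zero_of_actsAt hJ hℒ hD hinv hj hact
  · rintro ⟨j, hj, hact⟩ hreg
    exact ((Matrix.isUnit_iff_isUnit_det _).1 (hreg j hj)).ne_zero
      (det_hessian_eq_zero_of_actsAt hJ hℒ hD hinv hj hact)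
  · rintro ⟨j, hj, hact⟩ ⟨R, hR⟩ i hi
    by_contra hdet
    -- Full rank at i would force full rank at j, where the transformations act and the determinant
    -- is zero.
    refine (det_ne_zero_iff_rank_eq (hessian ℒ j)).2 ?_
      (det_hessian_eq_zero_of_actsAt hJ hℒ hD hinv hj hact)
    rw [hR j hj, ← hR i hi]
    exact (det_ne_zero_iff_rank_eq _).1 hdet
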